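/- Let $\mathcal A$ be an abelian category and let $H$ be a (small, abstract) group. Let $\mathrm{Pro}(\mathcal A)$ be the abelian category of pro-objects of $\mathcal A$, i.e. of formal small cofiltered limits of objects of $\mathcal A$, and let $H\text{-}\mathrm{Pro}(\mathcal A)$ be the abelian category of objects of $\mathrm{Pro}(\mathcal A)$ provided with an action of $H$ (from the left), with equivariant morphisms. Let $(\,\cdot\,)^H : H\text{-}\mathrm{Pro}(\mathcal A)\to \mathrm{Pro}(\mathcal A)$ be the fixed point functor $A\mapsto A^H=\bigcap_{\gamma\in H}\ker(\mathrm{id}_A-\gamma)$. *Notation.* - A resolution functor on an abelian category $\mathcal C$ is an exact functor $C:\mathcal C\to\mathcal C$ with a morphism of functors $\mathrm{Id}\to C$ such that $A\to C(A)$ is a monomorphism for every $A$. Then $C^*(A)$ denotes the complex $C^0(A)\to C^1(A)\to\cdots$, where $K^0(A)=A$, $C^i(A)=C(K^i(A))$, $K^{i+1}(A)=\mathrm{Coker}(K^i(A)\hookrightarrow C^i(A))$, and the differential is the composition $C^i(A)\twoheadrightarrow K^{i+1}(A)\hookrightarrow C^{i+1}(A)$. - For $A$ in $H\text{-}\mathrm{Pro}(\mathcal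 A)$ let $C_H(A)=\prod_{h\in H}A$ with projections $p_h$, on which $\gamma\in H$ acts by the morphism with components $\gamma\circ p_{\gamma^{-1}h}$, $h\in H$, and let $\iota:A\to C_H(A)$ be the morphism all of whose components are the identity. - For a $\mathbb ZH$-module $M$ and $A$ in $H\text{-}\mathrm{Pro}(\mathcal A)$, $\mathrm{Hom}(M,A)$ is the pro-object representing the functor $B\mapsto \mathrm{Hom}_{\mathbb Z}\bigl(M,\mathrm{Hom}_{\mathrm{Pro}(\mathcal A)}(B,A)\bigr)$, with the diagonal action of $H$: $(\gamma\alpha)(m)=\gamma\circ\alpha(\gamma^{-1}m)$. - An additive functor $F:\mathcal C\to\mathcal D$ of abelian categories is right derivable (in Deligne's sense, on bounded below complexes) if for every $K$ in $K^+(\mathcal C)$ the ind-object $\text{“}\varinjlim\text{”}\,F(K')$ of $D^+(\mathcal D)$, indexed by the quasi-isomorphisms $K\to K'$ in $K^+(\mathcal C)$, is essentially constant. A total right derived functor of $F$ is a functor $RF:D^+(\mathcal C)\to D^+(\mathcal D)$ with a natural morphism $\alpha: F(K)\to RF(K)$, $K\in K^+(\mathcal C)$, which identifies $RF(K)$ with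 the value of this ind-object for every $K$. - Let $R$ be a functor from $\mathcal C$ to the complexes $R^0\to R^1\to\cdots$ in $\mathcal D$, with a natural coaugmentation $\eta:F\to R^0$ satisfying $d\circ\eta=0$. Extend $R$ to $C^+(\mathcal C)\to C^+(\mathcal D)$ by sending $K$ to the simple complex $R(K)$ associated with the double complex $R^q(K^p)$; $\eta$ gives a morphism $F(K)\to R(K)$. One says that $RF$ is induced by $R$ if there is an isomorphism $R(K)\cong RF(K)$ in $D^+(\mathcal D)$, natural in $K\in C^+(\mathcal C)$, whose composition with $F(K)\to R(K)$ is $\alpha$. **Theorem.** 1. $C_H$, with $\iota$, is a resolution functor on $H\text{-}\mathrm{Pro}(\mathcal A)$, and the functor $A\mapsto (C_H^*(A))^H$ from $H\text{-}\mathrm{Pro}(\mathcal A)$ to complexes in $\mathrm{Pro}(\mathcal A)$ is exact. 2. The functor $(\,\cdot\,)^H:H\text{-}\mathrm{Pro}(\mathcal A)\to\mathrm{Pro}(\mathcal A)$ is right derivable, and it has a total right derived functor $$R\Gamma(H,\,\cdot\,):D^+(H\text{-}\mathrm{Pro}(\mathcal A))\longrightarrow D^+(\mathrm{Pro}(\mathcal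 A)).$$ 3. $R\Gamma(H,\,\cdot\,)$ is induced by the exact functor $(\,\cdot\,)^H\circ C_H^*$, with the coaugmentation $\iota^H:A^H\to C_H(A)^H$. 4. For every resolution $F_*\to\mathbb Z$ of the trivial $\mathbb ZH$-module $\mathbb Z$ by free $\mathbb ZH$-modules, $R\Gamma(H,\,\cdot\,)$ is induced by the functor $A\mapsto \mathrm{Hom}(F_*,A)^H$, with the coaugmentation $A^H=\mathrm{Hom}(\mathbb Z,A)^H\to\mathrm{Hom}(F_0,A)^H$. -/

import Mathlib

open CategoryTheory Limits

universe w₁ w₂ v u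

noncomputable section

namespace ProGroupCohomology

/-! ### Pro-objects of an abelian category -/

section ProObjects

variable {C : Type u} [Category.{v} C]

/-- An ind-object is a left exact presheaf. -/
lemma preservesFiniteLimits_of_isIndObject {F : Cᵒᵖ ⥤ Type v} (hF : IsIndObject F) :
    PreservesFiniteLimits F := by
  obtain ⟨⟨P⟩⟩ := hF
  have h1 : PreservesFiniteLimits (P.F ⋙ yoneda).flip := by
    constructor
    intro J _ _
    apply preservesLimitsOfShape_of_evaluation
    intro k
    exact inferInstanceAs (PreservesLimitsOfShape J (yoneda.obj (P.F.obj k)))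
  have h2 : PreservesFiniteLimits ((P.F ⋙ yoneda).flip ⋙ colim) := inferInstance
  have e : F ≅ (P.F ⋙ yoneda).flip ⋙ colim :=
    (P.isColimit.coconePointUniqueUpToIso (colimit.isColimit _)) ≪≫ colimitIsoFlipCompColim _
  exact preservesFiniteLimits_of_natIso e.symm

/-- The additive structure on the ind-objects of an additive category: an ind-object is a
left exact presheaf of sets, hence canonically a left exact presheaf of abelian groups. -/
@[reducible]
def indPreadditive [Preadditive C] [HasFiniteColimits C] : Preadditive (Ind C) :=
  haveI : HasFiniteBiproducts Cᵒᵖ := HasFiniteBiproducts.of_hasFiniteProducts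
  .ofFullyFaithful ((((Ind.equivalence C).fullyFaithfulFunctor.comp
    (ObjectProperty.fullyFaithfulιOfLE (P := IsIndObject (C := C))
      (P' := leftExactFunctor Cᵒᵖ (Type v))
      (fun _ hF => preservesFiniteLimits_of_isIndObject hF))).comp
      (AddCommGrpCat.leftExactFunctorForgetEquivalence Cᵒᵖ).symm.fullyFaithfulFunctor).comp
      (ObjectProperty.fullyFaithfulι _))

/-- The ind-objects of an abelian category (not assumed to be small) form an abelian category. -/
@[reducible]
def indAbelian [Abelian C] : Abelian (Ind C) :=
  letI : Preadditive (Ind C) := indPreadditive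
  haveI (X Y : Ind C) (f : X ⟶ Y) : IsIso (Abelian.coimageImageComparison f) := by
    obtain ⟨I, _, _, F, G, ϕ, ⟨i⟩⟩ := Ind.exists_nonempty_arrow_mk_iso_ind_lim (f := f)
    let i' : Arrow.mk (Abelian.coimageImageComparison f) ≅
        Arrow.mk (Abelian.coimageImageComparison ((Ind.lim I).map ϕ)) :=
      Abelian.coimageImageComparisonFunctor.mapIso i
    have : HasZeroObject (Ind C) := hasZeroObject_of_hasInitial_object
    have : (Ind.lim I : (I ⥤ C) ⥤ _).Additive :=
      Functor.additive_of_preserves_binary_products _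
    have := Iso.isIso_hom i'
    rw [Arrow.isIso_iff_isIso_of_isIso i'.hom,
      Arrow.isIso_iff_isIso_of_isIso
        (Abelian.PreservesCoimageImageComparison.iso (Ind.lim I) ϕ).inv]
    infer_instance
  .ofCoimageImageComparisonIsIso

/-- The category `Pro(A)` of pro-objects of `A`, i.e. of (formal) small cofiltered limits of
objects of `A`: the opposite of the category of ind-objects of `Aᵒᵖ`. -/
def Pro (A : Type u) [Category.{v} A] : Type (max u (v + 1)) := (Ind Aᵒᵖ)ᵒᵖ

instance (A : Type u) [Category.{v} A] : Category.{v} (Pro A) :=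
  inferInstanceAs (Category.{v} (Ind Aᵒᵖ)ᵒᵖ)

instance (A : Type u) [Category.{v} A] [Abelian A] : Abelian (Pro A) :=
  letI : Abelian (Ind Aᵒᵖ) := indAbelian
  inferInstanceAs (Abelian (Ind Aᵒᵖ)ᵒᵖ)

instance (A : Type u) [Category.{v} A] [Abelian A] : HasProducts.{v} (Pro A) :=
  fun J => inferInstanceAs (HasLimitsOfShape (Discrete J) (Ind Aᵒᵖ)ᵒᵖ)

end ProObjects

/-! ### Resolution functors and the resolutions that they define -/

section ResolutionFunctors

variable {C : Type*} [Category* C] [Abelian C]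

/-- A resolution functor: an exact endofunctor `R` with a monomorphism `A ⟶ R(A)`, natural
in `A`. -/
structure IsResolutionFunctor (R : C ⥤ C) (ι : 𝟭 C ⟶ R) : Prop where
  additive : R.Additive
  preservesFiniteLimits : PreservesFiniteLimits R
  preservesFiniteColimits : PreservesFiniteColimits R
  mono (X : C) : Mono (ι.app X)

variable (R : C ⥤ C) (ι : 𝟭 C ⟶ R)

/-- The functor `A ↦ Coker(A ⟶ R(A))`. -/
def cokerFunctor : C ⥤ C where
  obj X := cokernel (ι.app X)
  map f := cokernel.map _ _ f (R.map f) (ι.naturality f).symm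

/-- The projection `R(A) ⟶ Coker(A ⟶ R(A))`. -/
def cokerπ : R ⟶ cokerFunctor R ι where
  app X := cokernel.π (ι.app X)
  naturality X Y f := by simp [cokerFunctor]

lemma ι_cokerπ (X : C) : ι.app X ≫ (cokerπ R ι).app X = 0 :=
  cokernel.condition _

/-- The functors `K^i`: `K^0(A) = A` and `K^{i+1}(A) = Coker(K^i(A) ⟶ R(K^i(A)))`. -/
def resolutionK : ℕ → (C ⥤ C)
  | 0 => 𝟭 C
  | i + 1 => resolutionK i ⋙ cokerFunctor R ι

/-- The monomorphism `K^i(A) ⟶ R(K^i(A))`. -/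
def resolutionι (i : ℕ) : resolutionK R ι i ⟶ resolutionK R ι i ⋙ R :=
  Functor.whiskerLeft (resolutionK R ι i) ι

/-- The projection `R(K^i(A)) ⟶ K^{i+1}(A)`. -/
def resolutionπ (i : ℕ) : resolutionK R ι i ⋙ R ⟶ resolutionK R ι (i + 1) :=
  Functor.whiskerLeft (resolutionK R ι i) (cokerπ R ι)

lemma resolutionι_π (i : ℕ) : resolutionι R ι i ≫ resolutionπ R ι i = 0 := by
  ext X
  exact ι_cokerπ R ι _

/-- The differential `R(K^i(A)) ⟶ K^{i+1}(A) ⟶ R(K^{i+1}(A))`. -/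
def resolutionD (i : ℕ) : resolutionK R ι i ⋙ R ⟶ resolutionK R ι (i + 1) ⋙ R :=
  resolutionπ R ι i ≫ resolutionι R ι (i + 1)

lemma resolutionD_comp (i : ℕ) : resolutionD R ι i ≫ resolutionD R ι (i + 1) = 0 := by
  simp only [resolutionD, Category.assoc]
  rw [← Category.assoc (resolutionι R ι (i + 1)), resolutionι_π, zero_comp, comp_zero]

lemma resolutionD_app_comp (i : ℕ) (X : C) :
    (resolutionD R ι i).app X ≫ (resolutionD R ι (i + 1)).app X = 0 :=
  NatTrans.congr_app (resolutionD_comp R ι i) X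

/-- The `R`-resolution `R^0(A) ⟶ R^1(A) ⟶ ⋯` of `A`, where `R^i(A) = R(K^i(A))`. -/
def resolution : C ⥤ CochainComplex C ℕ where
  obj X := CochainComplex.of (fun i => (resolutionK R ι i ⋙ R).obj X)
    (fun i => (resolutionD R ι i).app X)
    (fun i => resolutionD_app_comp R ι i X)
  map f := CochainComplex.ofHom (fun i => (resolutionK R ι i ⋙ R).map f)
    (fun i => by
      dsimp only
      rw [CochainComplex.of_d, CochainComplex.of_d]
      exact (resolutionD R ι i).naturality f)

/-- The coaugmentation `A ⟶ R^0(A)`. -/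
def resolutionCoaugmentation : 𝟭 C ⟶ resolution R ι ⋙ HomologicalComplex.eval C _ 0 where
  app X := ι.app X
  naturality X Y f := by exact ι.naturality f

lemma resolutionCoaugmentation_d (X : C) :
    (resolutionCoaugmentation R ι).app X ≫ ((resolution R ι).obj X).d 0 1 = 0 := by
  have : ((resolution R ι).obj X).d 0 1 = (resolutionD R ι 0).app X :=
    CochainComplex.of_d (fun i => (resolutionK R ι i ⋙ R).obj X)
      (fun i => (resolutionD R ι i).app X) 0
  rw [this]
  have h : resolutionι R ι 0 ≫ resolutionD R ι 0 = 0 := by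
    rw [resolutionD, ← Category.assoc, resolutionι_π, zero_comp]
  exact NatTrans.congr_app h X

instance [R.PreservesZeroMorphisms] : (cokerFunctor R ι).PreservesZeroMorphisms where
  map_zero X Y := by
    have : Epi ((cokerπ R ι).app X) := inferInstanceAs (Epi (cokernel.π (ι.app X)))
    rw [← cancel_epi ((cokerπ R ι).app X), ← (cokerπ R ι).naturality]
    simp

instance [R.PreservesZeroMorphisms] (i : ℕ) : (resolutionK R ι i).PreservesZeroMorphisms := by
  induction i with
  | zero => exact inferInstanceAs ((𝟭 C).PreservesZeroMorphisms)
  | succ i _ => exact inferInstanceAs ((resolutionK R ι i ⋙ cokerFunctor R ι).PreservesZeroMorphisms)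

instance [R.PreservesZeroMorphisms] : (resolution R ι).PreservesZeroMorphisms where
  map_zero X Y := by
    ext i
    exact (resolutionK R ι i ⋙ R).map_zero X Y

end ResolutionFunctors
/-! ### Total complexes -/

section Total

open ComplexShape

/-- Total degree and signs for double complexes indexed by `ℤ × ℕ`: the total differential on the
summand of bidegree `(p, q)` is `d₁ + (-1)^p d₂`. -/
@[simps]
instance : TotalComplexShape (up ℤ) (up ℕ) (up ℤ) where
  π := fun ⟨p, q⟩ => p + q
  ε₁ := fun _ => 1
  ε₂ := fun ⟨p, _⟩ => p.negOnePow
  rel₁ := by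
    intro p p' h q
    simp only [up_Rel] at h ⊢
    lia
  rel₂ := by
    intro p q q' h
    simp only [up_Rel] at h ⊢
    lia
  ε₂_ε₁ := by
    intro p p' q q' h h'
    simp only [up_Rel] at h
    subst h
    simp [Int.negOnePow_succ]

lemma hasCoproduct_of_finite_support {D : Type*} [Category* D] [HasZeroMorphisms D]
    [HasFiniteCoproducts D] {I : Type*} (f : I → D) (s : Set I) [Finite s]
    (h : ∀ i, i ∉ s → IsZero (f i)) : HasCoproduct f := by
  classical
  let c : Cofan f := Cofan.mk (∐ fun i : s => f i) (fun i =>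
    if hi : i ∈ s then Sigma.ι (fun i : s => f i) ⟨i, hi⟩ else 0)
  exact ⟨⟨c, Cofan.IsColimit.mk c
    (fun t => (Limits.Sigma.desc fun i : s => t.inj i : (∐ fun i : s => f i) ⟶ t.pt))
    (fun t i => by
      by_cases hi : i ∈ s
      · simp [c, hi]
      · exact (h i hi).eq_of_src _ _)
    (fun t m hm => by
      refine Limits.Sigma.hom_ext (f := fun i : s => f i) _ _ (fun i => ?_)
      have h1 : c.inj i.1 = Sigma.ι (fun i : s => f i) i := dif_pos i.2
      have h2 := hm i.1
      rw [h1] at h2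
      rw [Sigma.ι_desc]
      exact h2)⟩⟩

variable {C D : Type*} [Category* C] [Category* D] [Abelian C] [Abelian D]
  (R : C ⥤ CochainComplex D ℕ) [R.PreservesZeroMorphisms]

/-- The double complex with `(R(K^p))^q` in bidegree `(p, q)`. -/
abbrev doubleComplex (K : CochainComplex C ℤ) : HomologicalComplex₂ D (up ℤ) (up ℕ) :=
  (R.mapHomologicalComplex (up ℤ)).obj K

lemma isZero_doubleComplex (K : CochainComplex C ℤ) (p : ℤ) (hp : IsZero (K.X p)) (q : ℕ) :
    IsZero (((doubleComplex R K).X p).X q) := by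
  have h1 : IsZero (R.obj (K.X p)) := R.map_isZero hp
  exact (HomologicalComplex.eval D (up ℕ) q).map_isZero h1

instance (K : CochainComplex.Plus C) : (doubleComplex R K.obj).HasTotal (up ℤ) := by
  intro n
  obtain ⟨m, hm⟩ := K.property
  let s : Set ((π (up ℤ) (up ℕ) (up ℤ)) ⁻¹' {n}) := {x | m ≤ x.1.1}
  have : Finite s := by
    refine Finite.of_injective
      (fun x : s => (⟨x.1.1.2, ?_⟩ : Set.Iio ((n - m).toNat + 1))) ?_
    · have h1 : x.1.1.1 + (x.1.1.2 : ℤ) = n := x.1.2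
      have h2 : m ≤ x.1.1.1 := x.2
      simp only [Set.mem_Iio]
      lia
    · rintro ⟨⟨⟨p, q⟩, h1⟩, h2⟩ ⟨⟨⟨p', q'⟩, h1'⟩, h2'⟩ h
      have h3 : q = q' := congrArg Subtype.val h
      have h4 : p + (q : ℤ) = n := h1
      have h5 : p' + (q' : ℤ) = n := h1'
      subst h3
      obtain rfl : p = p' := by lia
      rfl
  refine hasCoproduct_of_finite_support _ s (fun x hx => ?_)
  refine isZero_doubleComplex R _ _ ?_ _
  have hx' : ¬ m ≤ x.1.1 := hx
  exact K.obj.isZero_of_isStrictlyGE m _ (by lia)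

/-- The extension of a complex valued functor `R` to bounded below complexes: `K` is sent to the
simple complex associated with the double complex `(R(K^p))^q`. -/
def totPlus : CochainComplex.Plus C ⥤ CochainComplex.Plus D where
  obj K := ⟨(doubleComplex R K.obj).total (up ℤ), by
    obtain ⟨m, hm⟩ := K.property
    refine ⟨m, ?_⟩
    rw [CochainComplex.isStrictlyGE_iff]
    intro i hi
    rw [IsZero.iff_id_eq_zero]
    apply HomologicalComplex₂.total.hom_ext
    intro p q h
    have h' : p + (q : ℤ) = i := h
    exact (isZero_doubleComplex R _ _
      (K.obj.isZero_of_isStrictlyGE m _ (by lia)) _).eq_of_src _ _⟩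
  map f := ObjectProperty.homMk
    (HomologicalComplex₂.total.map ((R.mapHomologicalComplex (up ℤ)).map f.hom) (up ℤ))
  map_id K := by
    ext1
    simp
  map_comp f g := by
    ext1
    simp

variable {R} (F : C ⥤ D) [F.PreservesZeroMorphisms]

lemma totCoaugmentation_aux {A A' B B' B'' T T' : D} (a : A ⟶ B) (i : B ⟶ T) (d : T ⟶ T')
    (b : B ⟶ B') (i' : B' ⟶ T') (ε : ℤˣ) (b' : B ⟶ B'') (i'' : B'' ⟶ T') (d' : A ⟶ A')
    (a' : A' ⟶ B') (h : i ≫ d = b ≫ i' + ε • (b' ≫ i'')) (h0 : a ≫ b' = 0)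
    (h' : d' ≫ a' = a ≫ b) : (a ≫ i) ≫ d = d' ≫ a' ≫ i' := by
  rw [Category.assoc, h, Preadditive.comp_add, Linear.comp_units_smul, reassoc_of% h0,
    reassoc_of% h']
  simp

lemma totCoaugmentation_aux' {A A' B B' T T' : D} (g : A ⟶ A') (a : A ⟶ B) (a' : A' ⟶ B')
    (m : B ⟶ B') (i : B ⟶ T) (i' : B' ⟶ T') (t : T ⟶ T') (h : g ≫ a' = a ≫ m)
    (h' : i ≫ t = m ≫ i') : g ≫ a' ≫ i' = (a ≫ i) ≫ t := by
  rw [Category.assoc, h', reassoc_of% h]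

/-- A coaugmentation `F(A) ⟶ R^0(A)` extends to complexes: `F(K^n)` is mapped to the
summand `R^0(K^n)` of the simple complex. -/
def totCoaugmentation (η : F ⟶ R ⋙ HomologicalComplex.eval D (up ℕ) 0)
    (hη : ∀ X, η.app X ≫ (R.obj X).d 0 1 = 0) : F.mapCochainComplexPlus ⟶ totPlus R :=
  let a (X : C) : F.obj X ⟶ (R.obj X).X 0 := η.app X
  have ha {X Y : C} (f : X ⟶ Y) : F.map f ≫ a Y = a X ≫ (R.map f).f 0 := η.naturality f
  { app K := ObjectProperty.homMk
      { f := fun n => a (K.obj.X n) ≫ (doubleComplex R K.obj).ιTotal (up ℤ) n 0 n (by simp)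
        comm' := by
          intro n n' h
          have h2 : (doubleComplex R K.obj).ιTotal (up ℤ) n 0 n (by simp) ≫
              ((doubleComplex R K.obj).total (up ℤ)).d n n' =
              (R.map (K.obj.d n n')).f 0 ≫
                (doubleComplex R K.obj).ιTotal (up ℤ) n' 0 n' (by simp) +
              n.negOnePow • ((R.obj (K.obj.X n)).d 0 1 ≫
                (doubleComplex R K.obj).ιTotal (up ℤ) n 1 n' (by simpa using h)) := by
            rw [HomologicalComplex₂.total_d, Preadditive.comp_add, HomologicalComplex₂.ι_D₁,
              HomologicalComplex₂.ι_D₂, HomologicalComplex₂.d₁_eq _ _ h _ _ (by simp),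
              HomologicalComplex₂.d₂_eq _ _ _ (show (up ℕ).Rel 0 1 by simp) _ (by simpa using h)]
            simp [-Functor.mapHomologicalComplex_obj_X, -Functor.mapHomologicalComplex_obj_d]
            rfl
          have h3 : a (K.obj.X n) ≫ (R.obj (K.obj.X n)).d 0 1 = 0 := hη _
          have h6 := ha (K.obj.d n n')
          exact totCoaugmentation_aux _ _ _ _ _ _ _ _ _ _ h2 h3 h6 }
    naturality K L f := by
      ext n
      have h5 : (doubleComplex R K.obj).ιTotal (up ℤ) n 0 n (by simp) ≫
          (HomologicalComplex₂.total.map ((R.mapHomologicalComplex (up ℤ)).map f.hom)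
            (up ℤ)).f n =
          (R.map (f.hom.f n)).f 0 ≫ (doubleComplex R L.obj).ιTotal (up ℤ) n 0 n (by simp) :=
        HomologicalComplex₂.ιTotal_map _ _ _ _ _ _ _ _
      exact totCoaugmentation_aux' _ _ _ _ _ _ _ (ha (f.hom.f n)) h5 }

end Total
/-! ### Derived functors in the sense of Deligne -/

section Deligne

/-- A filtered diagram `T : J ⥤ E` is essentially constant with value the vertex of the cocone `c`:
the ind-object `“colim” T` is, via `c`, isomorphic to the constant ind-object `c.pt`. -/
def IsEssentiallyConstant {J E : Type*} [Category* J] [Category* E] (T : J ⥤ E) (c : Cocone T) :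
    Prop :=
  ∃ (j₀ : J) (s : c.pt ⟶ T.obj j₀), s ≫ c.ι.app j₀ = 𝟙 c.pt ∧
    ∀ j : J, ∃ (k : J) (a : j ⟶ k) (b : j₀ ⟶ k), T.map a = c.ι.app j ≫ s ≫ T.map b

variable {K E D : Type*} [Category* K] [Category* E] [Category* D]

/-- The diagram `(X ⟶ X') ↦ T(X')`, indexed by the morphisms `X ⟶ X'` in `W`; the ind-object that
it defines is the value at `X` of the right derived functor of `T`. -/
def derivedDiagram (W : MorphismProperty K) (T : K ⥤ E) (X : K) : W.Under ⊤ X ⥤ E :=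
  MorphismProperty.Under.forget W ⊤ X ⋙ Under.forget X ⋙ T

/-- `T` is right derivable at every object: all the ind-objects `“colim” T(X')` over the morphisms
`X ⟶ X'` in `W` are essentially constant. -/
def IsRightDerivable (W : MorphismProperty K) (T : K ⥤ E) : Prop :=
  ∀ X : K, ∃ c : Cocone (derivedDiagram W T X), IsEssentiallyConstant _ c

/-- Given a localization functor `L` with respect to `W` and `α : T ⟶ L ⋙ RT`, the cocone with
vertex `RT(X)` whose component at `s : X ⟶ X'` is `T(X') ⟶ RT(X') ≅ RT(X)`. -/
def derivedCocone (W : MorphismProperty K) {T : K ⥤ E} {L : K ⥤ D} [L.IsLocalization W]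
    {RT : D ⥤ E} (α : T ⟶ L ⋙ RT) (X : K) : Cocone (derivedDiagram W T X) where
  pt := RT.obj (L.obj X)
  ι :=
    { app := fun j => α.app j.right ≫ RT.map (Localization.isoOfHom L W j.hom j.prop).inv
      naturality := fun i j f => by
        have h1 : i.hom ≫ f.right = j.hom := MorphismProperty.Under.w f
        have h2 : L.map f.right ≫ (Localization.isoOfHom L W j.hom j.prop).inv =
            (Localization.isoOfHom L W i.hom i.prop).inv := by
          rw [Iso.comp_inv_eq, Iso.eq_inv_comp]
          simp [← h1]
        have h3 : T.map f.right ≫ α.app j.right = α.app i.right ≫ RT.map (L.map f.right) :=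
          α.naturality f.right
        change T.map f.right ≫ α.app j.right ≫ _ = (α.app i.right ≫ _) ≫ 𝟙 _
        rw [reassoc_of% h3, ← RT.map_comp, h2, Category.comp_id] }

/-- `RT`, together with `α : T ⟶ L ⋙ RT`, is the total right derived functor of `T`: for every `X`
the ind-object `“colim” T(X')` is essentially constant with value `RT(X)`. -/
def IsTotalRightDerived (W : MorphismProperty K) {T : K ⥤ E} {L : K ⥤ D} [L.IsLocalization W]
    (RT : D ⥤ E) (α : T ⟶ L ⋙ RT) : Prop :=
  ∀ X : K, IsEssentiallyConstant _ (derivedCocone W α X)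

variable {A B : Type*} [Category* A] [Category* B] [Abelian A] [Abelian B]
  [HasDerivedCategory A] [HasDerivedCategory B] (F : A ⥤ B) [F.Additive]

/-- The functor `K⁺(A) ⥤ D⁺(B)` induced by an additive functor `F : A ⥤ B`. -/
abbrev toDerivedPlus : HomotopyCategory.Plus A ⥤ DerivedCategory.Plus B :=
  F.mapHomotopyCategoryPlus ⋙ DerivedCategory.Plus.Qh

/-- The additive functor `F : A ⥤ B` is right derivable on bounded below complexes. -/
def IsRightDerivablePlus : Prop :=
  IsRightDerivable (HomotopyCategory.Plus.quasiIso A) (toDerivedPlus F)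

/-- `RF : D⁺(A) ⥤ D⁺(B)`, together with `α`, is the total right derived functor of `F`. -/
def IsTotalRightDerivedPlus (RF : DerivedCategory.Plus A ⥤ DerivedCategory.Plus B)
    (α : toDerivedPlus F ⟶ DerivedCategory.Plus.Qh ⋙ RF) : Prop :=
  IsTotalRightDerived (HomotopyCategory.Plus.quasiIso A) RF α

/-- The identification of the two functors `C⁺(A) ⥤ D⁺(B)` that are induced by `F`. -/
def mapPlusIso : F.mapCochainComplexPlus ⋙ DerivedCategory.Plus.Q ≅
    HomotopyCategory.Plus.quotient A ⋙ toDerivedPlus F :=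
  NatIso.ofComponents (fun _ => Iso.refl _) (fun f => by
    refine (Category.comp_id _).trans (Eq.trans ?_ (Category.id_comp _).symm)
    rfl)

/-- `RF : D⁺(A) ⥤ D⁺(B)`, together with `α`, is induced by the complex valued functor
`R : A ⥤ C(B)` with its coaugmentation `η : F ⟶ R^0`: the square formed by `RF` and the extension
`C⁺(A) ⥤ C⁺(B)` of `R` commutes up to an isomorphism that is compatible with `η` and `α`. -/
def IsInducedBy {F : A ⥤ B} [F.Additive] (RF : DerivedCategory.Plus A ⥤ DerivedCategory.Plus B)
    (α : toDerivedPlus F ⟶ DerivedCategory.Plus.Qh ⋙ RF)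
    (R : A ⥤ CochainComplex B ℕ) [R.PreservesZeroMorphisms]
    (η : F ⟶ R ⋙ HomologicalComplex.eval B (ComplexShape.up ℕ) 0)
    (hη : ∀ X, η.app X ≫ (R.obj X).d 0 1 = 0) : Prop :=
  ∃ e : totPlus R ⋙ DerivedCategory.Plus.Q ≅ DerivedCategory.Plus.Q ⋙ RF,
    Functor.whiskerRight (totCoaugmentation F η hη) DerivedCategory.Plus.Q ≫ e.hom =
      (mapPlusIso F).hom ≫ Functor.whiskerLeft (HomotopyCategory.Plus.quotient A) α

end Deligne

/-! ### Objects with a group action -/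

section Actions

variable {P : Type u} [Category.{v} P] [Abelian P] [HasProducts.{v} P] {H : Type v} [Group H]

/-- The automorphism of the underlying object of `A` given by `γ ∈ H`. -/
def act (A : Action P H) (γ : H) : A.V ⟶ A.V := A.ρ γ

lemma act_one (A : Action P H) : act A 1 = 𝟙 A.V := A.ρ_one

lemma act_mul (A : Action P H) (γ δ : H) : act A (γ * δ) = act A δ ≫ act A γ :=
  A.ρ.map_mul γ δ

lemma act_comm {A B : Action P H} (f : A ⟶ B) (γ : H) : act A γ ≫ f.hom = f.hom ≫ act B γ :=
  f.comm γ

/-- An object with an `H`-action from the endomorphisms given by the elements of `H`. -/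
def mkAction (X : P) (a : H → (X ⟶ X)) (h1 : a 1 = 𝟙 X) (hmul : ∀ γ δ, a (γ * δ) = a δ ≫ a γ) :
    Action P H where
  V := X
  ρ := { toFun := fun γ => a γ, map_one' := h1, map_mul' := hmul }

/-- The morphism `A ⟶ ∏_{γ ∈ H} A` with components `e - γ`. -/
def idSubAction (A : Action P H) : A.V ⟶ ∏ᶜ fun _ : H => A.V :=
  Pi.lift fun γ => 𝟙 A.V - act A γ

lemma idSubAction_π (A : Action P H) (γ : H) :
    idSubAction A ≫ Pi.π (fun _ : H => A.V) γ = 𝟙 A.V - act A γ := by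
  simp [idSubAction]

variable (P H) in
/-- The fixed point functor `A ↦ A^H = ⋂_γ Ker(e - γ)`. -/
def fixedPoints : Action P H ⥤ P where
  obj A := kernel (idSubAction A)
  map {A B} f := kernel.map _ _ f.hom (Limits.Pi.map fun _ => f.hom) (by
    refine Limits.Pi.hom_ext _ _ fun γ => ?_
    simp only [Category.assoc, Pi.map_π, idSubAction_π]
    rw [reassoc_of% idSubAction_π]
    simp [Preadditive.sub_comp, Preadditive.comp_sub, act_comm f γ])

/-- The inclusion `A^H ⟶ A`. -/
def fixedPointsι (A : Action P H) : (fixedPoints P H).obj A ⟶ A.V := kernel.ι _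

instance (A : Action P H) : Mono (fixedPointsι A) := inferInstanceAs (Mono (kernel.ι _))

lemma fixedPoints_map_ι {A B : Action P H} (f : A ⟶ B) :
    (fixedPoints P H).map f ≫ fixedPointsι B = fixedPointsι A ≫ f.hom := by
  simp [fixedPoints, fixedPointsι]

/-- `A^H` is the largest subobject of `A` on which all `γ ∈ H` act as the identity. -/
lemma fixedPoints_factors_iff (A : Action P H) {B : P} (f : B ⟶ A.V) :
    (∃ g : B ⟶ (fixedPoints P H).obj A, g ≫ fixedPointsι A = f) ↔
      ∀ γ : H, f ≫ act A γ = f := by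
  constructor
  · rintro ⟨g, rfl⟩ γ
    have h : fixedPointsι A ≫ idSubAction A ≫ Pi.π (fun _ : H => A.V) γ = 0 := by
      rw [← Category.assoc]
      exact (congrArg (· ≫ _) (kernel.condition (idSubAction A))).trans zero_comp
    rw [idSubAction_π, Preadditive.comp_sub, Category.comp_id, sub_eq_zero] at h
    rw [Category.assoc, ← h]
  · intro h
    refine ⟨kernel.lift (idSubAction A) f (Limits.Pi.hom_ext _ _ fun γ => ?_),
      kernel.lift_ι _ _ _⟩
    rw [Category.assoc, idSubAction_π, Preadditive.comp_sub, h γ]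
    simp

instance : (fixedPoints P H).Additive where
  map_add {A B f g} := by
    rw [← cancel_mono (fixedPointsι B)]
    simp [Preadditive.add_comp, Preadditive.comp_add, fixedPoints_map_ι]

section

variable {X Y Z : P}

lemma powMap_id (X : P) : (Limits.Pi.map fun _ : H => 𝟙 X) = 𝟙 (∏ᶜ fun _ : H => X) :=
  Limits.Pi.hom_ext _ _ fun h => by simp

lemma powMap_comp (f : X ⟶ Y) (g : Y ⟶ Z) : (Limits.Pi.map fun _ : H => f ≫ g) =
    (Limits.Pi.map fun _ : H => f) ≫ (Limits.Pi.map fun _ : H => g) :=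
  Limits.Pi.hom_ext _ _ fun h => by simp

lemma powMap_add (f g : X ⟶ Y) : (Limits.Pi.map fun _ : H => f + g) =
    (Limits.Pi.map fun _ : H => f) + (Limits.Pi.map fun _ : H => g) :=
  Limits.Pi.hom_ext _ _ fun h => by simp [Preadditive.add_comp, Preadditive.comp_add]

lemma diag_powMap (f : X ⟶ Y) : f ≫ (Pi.lift fun _ : H => 𝟙 Y) =
    (Pi.lift fun _ : H => 𝟙 X) ≫ (Limits.Pi.map fun _ : H => f) :=
  Limits.Pi.hom_ext _ _ fun h => by simp

end

variable (P H) in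
/-- The resolution functor `C_H(A) = ∏_{h ∈ H} A`, on which `γ` acts by the family of morphisms
`γ_h = γ ∘ p_{γ⁻¹ h}`. -/
def CH : Action P H ⥤ Action P H where
  obj A := mkAction (∏ᶜ fun _ : H => A.V)
    (fun γ => Pi.lift fun h => Pi.π (fun _ : H => A.V) (γ⁻¹ * h) ≫ act A γ)
    (by
      refine Limits.Pi.hom_ext _ _ fun h => ?_
      simp [act_one])
    (fun γ δ => by
      refine Limits.Pi.hom_ext _ _ fun h => ?_
      simp [act_mul, mul_assoc])
  map {A B} f :=
    { hom := (Limits.Pi.map fun _ => f.hom : (∏ᶜ fun _ : H => A.V) ⟶ ∏ᶜ fun _ : H => B.V)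
      comm := fun γ => by
        change (Pi.lift fun h => Pi.π (fun _ : H => A.V) (γ⁻¹ * h) ≫ act A γ) ≫
          (Limits.Pi.map fun _ => f.hom) = (Limits.Pi.map fun _ => f.hom) ≫
          (Pi.lift fun h => Pi.π (fun _ : H => B.V) (γ⁻¹ * h) ≫ act B γ)
        refine Limits.Pi.hom_ext _ _ fun h => ?_
        simp [act_comm f γ] }
  map_id A := Action.hom_ext _ _ (powMap_id A.V)
  map_comp f g := Action.hom_ext _ _ (powMap_comp f.hom g.hom)

instance : (CH P H).Additive where
  map_add {A B f g} := Action.hom_ext _ _ (powMap_add f.hom g.hom)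

variable (P H) in
/-- The morphism `ι : A ⟶ C_H(A)` all of whose components are the identity. -/
def CHι : 𝟭 (Action P H) ⟶ CH P H where
  app A :=
    { hom := (Pi.lift fun _ => 𝟙 A.V : A.V ⟶ ∏ᶜ fun _ : H => A.V)
      comm := fun γ => by
        change act A γ ≫ (Pi.lift fun _ => 𝟙 A.V) = (Pi.lift fun _ => 𝟙 A.V) ≫
          (Pi.lift fun h => Pi.π (fun _ : H => A.V) (γ⁻¹ * h) ≫ act A γ)
        refine Limits.Pi.hom_ext _ _ fun h => ?_
        simp }
  naturality A B f := Action.hom_ext _ _ (diag_powMap f.hom)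

/-- The morphism `∏_{m ∈ M} X ⟶ ∏_{(m, n) ∈ M × M} X` with components `p_{m + n} - (p_m + p_n)`. -/
def addDefect (M : Type v) [AddCommGroup M] (X : P) :
    (∏ᶜ fun _ : M => X) ⟶ ∏ᶜ fun _ : M × M => X :=
  Pi.lift fun p => Pi.π (fun _ : M => X) (p.1 + p.2) -
    (Pi.π (fun _ : M => X) p.1 + Pi.π (fun _ : M => X) p.2)

lemma addDefect_π (M : Type v) [AddCommGroup M] (X : P) (m n : M) :
    addDefect M X ≫ Pi.π (fun _ : M × M => X) (m, n) = Pi.π (fun _ : M => X) (m + n) -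
      (Pi.π (fun _ : M => X) m + Pi.π (fun _ : M => X) n) := by
  simp [addDefect]

/-- The object `Hom(M, X)`, for an abelian group `M`: the subobject of `∏_{m ∈ M} X` on which
`p_{m + n} = p_m + p_n`; see `homEquiv` for its universal property. -/
def homObj (M : Type v) [AddCommGroup M] (X : P) : P := kernel (addDefect M X)

section

variable {M N : Type v} [AddCommGroup M] [AddCommGroup N] {X Y Z : P}

/-- Evaluation at `m`. -/
def homEval (m : M) : homObj M X ⟶ X := kernel.ι (addDefect M X) ≫ Pi.π _ m

lemma homEval_add (m n : M) : homEval (m + n) = (homEval m + homEval n : homObj M X ⟶ X) := by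
  have h : kernel.ι (addDefect M X) ≫ addDefect M X ≫ Pi.π (fun _ : M × M => X) (m, n) = 0 := by
    rw [kernel.condition_assoc, zero_comp]
  rw [addDefect_π, Preadditive.comp_sub, Preadditive.comp_add, sub_eq_zero] at h
  exact h

/-- The morphism `Z ⟶ Hom(M, X)` given by a homomorphism from `M` to the group of morphisms
`Z ⟶ X`. -/
def homLift (f : M →+ (Z ⟶ X)) : Z ⟶ homObj M X :=
  kernel.lift _ (Pi.lift fun m => f m) (by
    refine Limits.Pi.hom_ext _ _ fun p => ?_
    rw [Category.assoc, addDefect_π]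
    simp [Preadditive.comp_sub, Preadditive.comp_add])

lemma homLift_eval (f : M →+ (Z ⟶ X)) (m : M) : homLift f ≫ homEval m = f m := by
  refine (Category.assoc _ _ _).symm.trans
    ((congrArg (· ≫ _) (kernel.lift_ι (addDefect M X) _ _)).trans ?_)
  exact limit.lift_π _ _

lemma homObj_ext {f g : Z ⟶ homObj M X} (h : ∀ m, f ≫ homEval m = g ≫ homEval m) : f = g := by
  refine (cancel_mono (kernel.ι (addDefect M X))).1 (Limits.Pi.hom_ext _ _ fun m => ?_)
  exact (Category.assoc _ _ _).trans ((h m).trans (Category.assoc _ _ _).symm)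

/-- `Hom(M, X)` represents the functor `Z ↦ {group homomorphisms from M to Hom(Z, X)}`. -/
def homEquiv : (Z ⟶ homObj M X) ≃ (M →+ (Z ⟶ X)) where
  toFun f := AddMonoidHom.mk' (fun m => f ≫ homEval m)
    (fun m n => by rw [homEval_add, Preadditive.comp_add])
  invFun f := homLift f
  left_inv f := homObj_ext fun m => by rw [homLift_eval]; rfl
  right_inv f := by
    ext m
    exact homLift_eval f m

/-- The functoriality of `Hom(M, X)`. -/
def homMap (φ : N →+ M) (f : X ⟶ Y) : homObj M X ⟶ homObj N Y :=
  homLift (AddMonoidHom.mk' (fun n => homEval (φ n) ≫ f) (fun a b => by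
    rw [map_add, homEval_add, Preadditive.add_comp]))

lemma homMap_eval (φ : N →+ M) (f : X ⟶ Y) (n : N) :
    homMap φ f ≫ homEval n = homEval (φ n) ≫ f :=
  homLift_eval _ _

end

/-- The additive endomorphism of a `ℤH`-module given by an element of `H`. -/
def smulHom (M : ModuleCat.{v} (MonoidAlgebra ℤ H)) (γ : H) : M →+ M :=
  DistribSMul.toAddMonoidHom M (MonoidAlgebra.of ℤ H γ)

lemma smulHom_one (M : ModuleCat.{v} (MonoidAlgebra ℤ H)) (x : M) : smulHom M 1 x = x := by
  change MonoidAlgebra.of ℤ H 1 • x = x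
  rw [map_one, one_smul]

lemma smulHom_mul (M : ModuleCat.{v} (MonoidAlgebra ℤ H)) (γ δ : H) (x : M) :
    smulHom M (γ * δ) x = smulHom M γ (smulHom M δ x) := by
  change MonoidAlgebra.of ℤ H (γ * δ) • x = _
  rw [map_mul, mul_smul]
  rfl

lemma smulHom_comm {M N : ModuleCat.{v} (MonoidAlgebra ℤ H)} (φ : N ⟶ M) (γ : H) (x : N) :
    φ (smulHom N γ x) = smulHom M γ (φ x) :=
  φ.hom.map_smul (MonoidAlgebra.of ℤ H γ) x

/-- `Hom(M, A)` with the diagonal action of `H`: `γ` sends `α` to `m ↦ γ ∘ α(γ⁻¹ m)`. -/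
def homAction (M : ModuleCat.{v} (MonoidAlgebra ℤ H)) (A : Action P H) : Action P H :=
  mkAction (homObj M A.V) (fun γ => homMap (smulHom M γ⁻¹) (act A γ))
    (homObj_ext fun m => by
      rw [homMap_eval, inv_one, smulHom_one, act_one, Category.comp_id, Category.id_comp])
    (fun γ δ => homObj_ext fun m => by
      rw [homMap_eval, Category.assoc, homMap_eval, ← Category.assoc, homMap_eval, mul_inv_rev,
        smulHom_mul, act_mul, Category.assoc])

/-- The functoriality of `Hom(M, A)` with its diagonal action. -/
def homActionMap {M N : ModuleCat.{v} (MonoidAlgebra ℤ H)} (φ : N ⟶ M) {A B : Action P H}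
    (f : A ⟶ B) : homAction M A ⟶ homAction N B where
  hom := (homMap φ.hom.toAddMonoidHom f.hom : homObj M A.V ⟶ homObj N B.V)
  comm γ := by
    change homMap (smulHom M γ⁻¹) (act A γ) ≫ homMap φ.hom.toAddMonoidHom f.hom =
      homMap φ.hom.toAddMonoidHom f.hom ≫ homMap (smulHom N γ⁻¹) (act B γ)
    refine homObj_ext fun m => ?_
    have h : φ.hom.toAddMonoidHom (smulHom N γ⁻¹ m) = smulHom M γ⁻¹ (φ.hom.toAddMonoidHom m) :=
      smulHom_comm φ γ⁻¹ m
    rw [Category.assoc, homMap_eval, ← Category.assoc, homMap_eval, Category.assoc, act_comm,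
      Category.assoc, homMap_eval, ← Category.assoc _ (homEval _) (act B γ), homMap_eval,
      Category.assoc, h]

lemma homAction_hom_ext {M : ModuleCat.{v} (MonoidAlgebra ℤ H)} {A B : Action P H}
    {f g : B ⟶ homAction M A}
    (h : ∀ m : M, (f.hom : B.V ⟶ homObj M A.V) ≫ homEval m =
      (g.hom : B.V ⟶ homObj M A.V) ≫ homEval m) : f = g :=
  Action.hom_ext _ _ (homObj_ext h)

lemma homActionMap_eval {M N : ModuleCat.{v} (MonoidAlgebra ℤ H)} (φ : N ⟶ M) {A B : Action P H}
    (f : A ⟶ B) (n : N) : ((homActionMap φ f).hom : homObj M A.V ⟶ homObj N B.V) ≫ homEval n =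
      homEval (φ n) ≫ f.hom :=
  homMap_eval _ _ _

lemma homActionMap_id (M : ModuleCat.{v} (MonoidAlgebra ℤ H)) (A : Action P H) :
    homActionMap (𝟙 M) (𝟙 A) = 𝟙 (homAction M A) :=
  homAction_hom_ext fun m => by
    refine (homActionMap_eval _ _ _).trans ?_
    exact (Category.comp_id _).trans (Category.id_comp _).symm

lemma homActionMap_comp {L M N : ModuleCat.{v} (MonoidAlgebra ℤ H)} (φ : N ⟶ M) (ψ : M ⟶ L)
    {A B C : Action P H} (f : A ⟶ B) (g : B ⟶ C) :
    homActionMap ψ f ≫ homActionMap φ g = homActionMap (φ ≫ ψ) (f ≫ g) :=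
  homAction_hom_ext fun m => by
    refine Eq.trans ?_ (homActionMap_eval _ _ _).symm
    refine (Category.assoc _ _ _).trans ?_
    refine (congrArg (_ ≫ ·) (homActionMap_eval φ g m)).trans ?_
    refine (Category.assoc _ _ _).symm.trans ?_
    refine (congrArg (· ≫ _) (homActionMap_eval ψ f (φ m))).trans ?_
    exact Category.assoc _ _ _

lemma homEval_zero {M : Type v} [AddCommGroup M] {X : P} :
    (homEval (0 : M) : homObj M X ⟶ X) = 0 := by
  have := homEval_add (X := X) (0 : M) 0
  rwa [add_zero, left_eq_add] at this

lemma homActionMap_zero_left (M N : ModuleCat.{v} (MonoidAlgebra ℤ H)) {A B : Action P H}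
    (f : A ⟶ B) : homActionMap (0 : N ⟶ M) f = 0 :=
  homAction_hom_ext fun m => by
    refine (homActionMap_eval _ _ _).trans ?_
    refine (congrArg (· ≫ f.hom) (homEval_zero (M := M))).trans ?_
    exact zero_comp.trans zero_comp.symm

lemma homActionMap_zero_right {M N : ModuleCat.{v} (MonoidAlgebra ℤ H)} (φ : N ⟶ M)
    (A B : Action P H) : homActionMap φ (0 : A ⟶ B) = 0 :=
  homAction_hom_ext fun m => by
    refine (homActionMap_eval _ _ _).trans ?_
    exact comp_zero.trans zero_comp.symm

variable (P) in
/-- The functor `A ↦ Hom(F_*, A)`, for a complex `F_*` of `ℤH`-modules. -/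
def homComplex (F : ChainComplex (ModuleCat.{v} (MonoidAlgebra ℤ H)) ℕ) :
    Action P H ⥤ CochainComplex (Action P H) ℕ where
  obj A :=
    { X := fun n => homAction (F.X n) A
      d := fun i j => homActionMap (F.d j i) (𝟙 A)
      shape := fun i j h => by
        rw [F.shape j i (fun h' => h h'), homActionMap_zero_left]
      d_comp_d' := fun i j k _ _ => by
        refine (homActionMap_comp _ _ _ _).trans ?_
        rw [F.d_comp_d, homActionMap_zero_left] }
  map f :=
    { f := fun n => homActionMap (𝟙 (F.X n)) f
      comm' := fun i j _ => by
        simp [homActionMap_comp] }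
  map_id A := by
    ext1 n
    exact homActionMap_id _ _
  map_comp f g := by
    ext1 n
    exact (congrArg (homActionMap · (f ≫ g)) (Category.id_comp (𝟙 (F.X n))).symm).trans
      (homActionMap_comp _ _ _ _).symm

instance (F : ChainComplex (ModuleCat.{v} (MonoidAlgebra ℤ H)) ℕ) :
    (homComplex P F).PreservesZeroMorphisms where
  map_zero A B := by
    ext1 n
    exact homActionMap_zero_right _ _ _

variable (H) in
/-- A resolution `⋯ ⟶ F_1 ⟶ F_0 ⟶ ℤ ⟶ 0` of the trivial `ℤH`-module `ℤ` by free
`ℤH`-modules. -/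
structure FreeResolution where
  /-- the complex `F_*` of `ℤH`-modules -/
  complex : ChainComplex (ModuleCat.{v} (MonoidAlgebra ℤ H)) ℕ
  free (n : ℕ) : Module.Free (MonoidAlgebra ℤ H) (complex.X n)
  /-- the augmentation `F_0 ⟶ ℤ` -/
  aug : complex.X 0 →+ ℤ
  aug_smul (h : H) (x : complex.X 0) : aug (MonoidAlgebra.of ℤ H h • x) = aug x
  aug_surjective : Function.Surjective aug
  aug_eq_zero_iff (x : complex.X 0) : aug x = 0 ↔ ∃ y : complex.X 1, complex.d 1 0 y = x
  exactAt (n : ℕ) : complex.ExactAt (n + 1)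

/-- The homomorphism `x ↦ ε(x) • id` from `F_0` to the endomorphisms of `X`. -/
def augHom (F : FreeResolution H) (X : P) : F.complex.X 0 →+ (X ⟶ X) :=
  AddMonoidHom.mk' (fun x => F.aug x • 𝟙 X) (fun x y => by rw [map_add, add_smul])

variable (P) in
/-- The coaugmentation `A = Hom(ℤ, A) ⟶ Hom(F_0, A)`. -/
def homCoaugmentation (F : FreeResolution H) :
    𝟭 (Action P H) ⟶ homComplex P F.complex ⋙ HomologicalComplex.eval _ _ 0 where
  app A :=
    { hom := (homLift (augHom F A.V) : A.V ⟶ homObj (F.complex.X 0) A.V)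
      comm := fun γ => by
        change act A γ ≫ homLift (augHom F A.V) =
          homLift (augHom F A.V) ≫ homMap (smulHom (F.complex.X 0) γ⁻¹) (act A γ)
        refine homObj_ext fun m => ?_
        have h : F.aug (smulHom (F.complex.X 0) γ⁻¹ m) = F.aug m := F.aug_smul _ _
        rw [Category.assoc, homLift_eval, Category.assoc, homMap_eval, ← Category.assoc,
          homLift_eval]
        simp [augHom, h] }
  naturality A B f := by
    refine homAction_hom_ext fun m => ?_
    refine (Category.assoc _ _ _).trans ?_
    refine (congrArg (f.hom ≫ ·) (homLift_eval (augHom F B.V) m)).trans ?_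
    refine Eq.trans ?_ (Category.assoc _ _ _).symm
    refine Eq.trans ?_ (congrArg (_ ≫ ·) (homActionMap_eval (𝟙 (F.complex.X 0)) f m)).symm
    refine Eq.trans ?_ (Category.assoc _ _ _)
    refine Eq.trans ?_ (congrArg (· ≫ f.hom) (homLift_eval (augHom F A.V) m)).symm
    simp [augHom]

lemma homCoaugmentation_d (F : FreeResolution H) (A : Action P H) :
    (homCoaugmentation P F).app A ≫ ((homComplex P F.complex).obj A).d 0 1 = 0 := by
  refine homAction_hom_ext (M := F.complex.X 1) fun m => ?_
  refine (Category.assoc _ _ _).trans ?_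
  refine (congrArg (_ ≫ ·) (homActionMap_eval (F.complex.d 1 0) (𝟙 A) m)).trans ?_
  refine (Category.assoc _ _ _).symm.trans ?_
  refine (congrArg (· ≫ (𝟙 A : A ⟶ A).hom)
    (homLift_eval (augHom F A.V) (F.complex.d 1 0 m))).trans ?_
  have h : F.aug (F.complex.d 1 0 m) = 0 := (F.aug_eq_zero_iff _).2 ⟨m, rfl⟩
  refine Eq.trans ?_ zero_comp.symm
  simp [augHom, h]

section FixedPointComplexes

variable (R : Action P H ⥤ CochainComplex (Action P H) ℕ)

/-- The functor `A ↦ R(A)^H`, for a complex valued functor `R`. -/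
abbrev fixedPointsComplex : Action P H ⥤ CochainComplex P ℕ :=
  R ⋙ (fixedPoints P H).mapHomologicalComplex (ComplexShape.up ℕ)

variable {R}
variable (η : 𝟭 (Action P H) ⟶ R ⋙ HomologicalComplex.eval _ _ 0)

/-- The coaugmentation `A^H ⟶ R^0(A)^H` deduced from `η : A ⟶ R^0(A)`. -/
def fixedPointsCoaugmentation :
    fixedPoints P H ⟶ fixedPointsComplex R ⋙ HomologicalComplex.eval P (ComplexShape.up ℕ) 0 where
  app A := (fixedPoints P H).map (η.app A)
  naturality A B f := by
    have h : f ≫ η.app B = η.app A ≫ (R.map f).f 0 := η.naturality f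
    exact ((fixedPoints P H).map_comp _ _).symm.trans
      ((congrArg _ h).trans ((fixedPoints P H).map_comp _ _))

lemma fixedPointsCoaugmentation_d (hη : ∀ A, η.app A ≫ (R.obj A).d 0 1 = 0) (A : Action P H) :
    (fixedPointsCoaugmentation η).app A ≫ ((fixedPointsComplex R).obj A).d 0 1 = 0 :=
  ((fixedPoints P H).map_comp _ _).symm.trans
    ((congrArg (fixedPoints P H).map (hη A)).trans ((fixedPoints P H).map_zero _ _))

end FixedPointComplexes

end Actions
end ProGroupCohomology

end

open ProGroupCohomology

noncomputable section

namespace ProGroupCohomology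

/-! ### Deligne derived functors and objects adapted to them -/

section DeligneFormal

variable {K E D : Type*} [Category* K] [Category* E] [Category* D]
  {W : MorphismProperty K} {T : K ⥤ E} {L : K ⥤ D} [L.IsLocalization W] {RT : D ⥤ E}
  {P : ObjectProperty K}

/-! The fixed point functor `F` is compared with two complex valued functors `R`, namely
`C_H^*(·)^H` and `Hom(F_*, ·)^H`. Each is exact on all objects, and each computes `F` on one class
of acyclic objects into which every bounded below complex can be resolved functorially.

Exactness. Filtered colimits in `Ind(Aᵒᵖ)` are exact, hence so are coproducts there and products in
`Pro(A)`; this is the only special property of pro-objects that is used (`HasExactPowers`). It makes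
`C_H` exact, and by the `3 × 3` lemma also the functors `K^i`. A fixed family in `C_H(A)` is
determined by its component at `1`, so `C_H(A)^H ≅ A` and `C_H^*(·)^H` is exact. For `M` free with
basis `J`, `Hom(M, A)^H` is the power of `A` indexed by `J`, so `Hom(F_*, ·)^H` is exact. Hence the
extension of `R` to bounded below complexes preserves quasi-isomorphisms (`quasiIso_totPlus_map`).

Acyclic objects. These are the `A` for which `A ⟶ C_H(A)` splits equivariantly (`IsSplit`). Every
`C_H(B)` is such an object (`isSplit_CH_obj`), and so are retracts and the finite sums that form the
terms of the total complex `C_H^*(K)` (`isSplit_totPlus`). For split `A` the complex `C_H^*(A)` is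
spliced from split short exact sequences, so it stays exact after taking fixed points
(`IsSplit.isCoresolution`). Moreover `Hom(M, C_H(B))^H` is the object of all additive maps from `M`
to `B`, and `F_* ⟶ ℤ` is split exact over `ℤ`; so `C_H(B)`, and its retract `A`, are acyclic for
`Hom(F_*, ·)^H` too.

Conclusion. Put `I(K) = C_H^*(K)`. Then `K ⟶ I(K)` and `F(I(K)) ⟶ R(I(K))` are quasi-isomorphisms.
As `R` inverts quasi-isomorphisms, it descends to `D⁺` and gives a total right derived functor
(`exists_isTotalRightDerived`). Conversely, `α` is an isomorphism on the `I(K)` for every total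
right derived functor `RF`, and `R(K) ≅ R(I(K)) ≅ F(I(K)) ≅ RF(I(K)) ≅ RF(K)`
(`exists_iso_of_isTotalRightDerived`). Statements on total complexes are proved by clearing one row
or column at a time, up to refinements, without spectral sequences. -/

/-- The morphism `T(Y) ⟶ RT(Y) ≅ RT(X)` given by `s : X ⟶ Y` in `W`. -/
def toDerivedObj (α : T ⟶ L ⋙ RT) {X Y : K} (s : X ⟶ Y) (hs : W s) :
    T.obj Y ⟶ RT.obj (L.obj X) :=
  (α.app Y : T.obj Y ⟶ RT.obj (L.obj Y)) ≫ RT.map (Localization.isoOfHom L W s hs).inv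

variable {α : T ⟶ L ⋙ RT}

lemma map_toDerivedObj {X Y Z : K} (s : X ⟶ Y) (hs : W s) (t : X ⟶ Z) (ht : W t) (a : Y ⟶ Z)
    (h : s ≫ a = t) : T.map a ≫ toDerivedObj α t ht = toDerivedObj α s hs := by
  have h2 : L.map a ≫ (Localization.isoOfHom L W t ht).inv =
      (Localization.isoOfHom L W s hs).inv := by
    rw [Iso.comp_inv_eq, Iso.eq_inv_comp]
    simp [← h]
  have h3 : T.map a ≫ α.app Z = α.app Y ≫ RT.map (L.map a) := α.naturality a
  rw [toDerivedObj, reassoc_of% h3, ← RT.map_comp, h2, toDerivedObj]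

lemma isIso_toDerivedObj_iff {X Y : K} (s : X ⟶ Y) (hs : W s) :
    IsIso (toDerivedObj α s hs) ↔
      IsIso (α.app Y : T.obj Y ⟶ RT.obj (L.obj Y)) :=
  isIso_comp_right_iff _ _

/-- The definition of total right derived functors in terms of the objects of `K`. -/
lemma isTotalRightDerived_iff : IsTotalRightDerived W RT α ↔
    ∀ X : K, ∃ (Y₀ : K) (s₀ : X ⟶ Y₀) (hs₀ : W s₀) (σ : RT.obj (L.obj X) ⟶ T.obj Y₀),
      σ ≫ toDerivedObj α s₀ hs₀ = 𝟙 _ ∧ ∀ (Y : K) (s : X ⟶ Y) (hs : W s),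
        ∃ (Z : K) (t : X ⟶ Z) (_ : W t) (a : Y ⟶ Z) (b : Y₀ ⟶ Z), s ≫ a = t ∧ s₀ ≫ b = t ∧
          T.map a = toDerivedObj α s hs ≫ σ ≫ T.map b := by
  refine forall_congr' fun X => ⟨?_, ?_⟩
  · rintro ⟨j₀, σ, h1, h2⟩
    refine ⟨j₀.right, j₀.hom, j₀.prop, σ, h1, fun Y s hs => ?_⟩
    obtain ⟨k, a, b, h⟩ := h2 (MorphismProperty.Under.mk ⊤ s hs)
    exact ⟨k.right, k.hom, k.prop, a.right, b.right, MorphismProperty.Under.w a,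
      MorphismProperty.Under.w b, h⟩
  · rintro ⟨Y₀, s₀, hs₀, σ, h1, h2⟩
    refine ⟨MorphismProperty.Under.mk ⊤ s₀ hs₀, σ, h1, fun j => ?_⟩
    obtain ⟨Z, t, ht, a, b, ha, hb, h⟩ := h2 j.right j.hom j.prop
    exact ⟨MorphismProperty.Under.mk ⊤ t ht, MorphismProperty.Under.homMk a ha,
      MorphismProperty.Under.homMk b hb, h⟩

/-- If `α` is an isomorphism on a class of objects to which every object maps by a morphism in
`W`, then `RT` is the total right derived functor of `T`. -/
lemma isTotalRightDerived_of_isIso [W.HasLeftCalculusOfFractions]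
    (hP : ∀ X, ∃ (Y : K) (s : X ⟶ Y), W s ∧ P Y)
    (hα : ∀ Y, P Y → IsIso (α.app Y : T.obj Y ⟶ RT.obj (L.obj Y))) :
    IsTotalRightDerived W RT α := by
  rw [isTotalRightDerived_iff]
  intro X
  obtain ⟨Y₀, s₀, hs₀, hY₀⟩ := hP X
  have := (isIso_toDerivedObj_iff s₀ hs₀).2 (hα _ hY₀)
  refine ⟨Y₀, s₀, hs₀, inv (toDerivedObj α s₀ hs₀), by simp, fun Y s hs => ?_⟩
  -- The Ore condition completes `s` and `s₀` to a commutative square; its corner is then enlarged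
  -- to an object `Z` satisfying `P`.
  obtain ⟨ψ, h⟩ := (MorphismProperty.RightFraction.mk (W := W) s hs s₀).exists_leftFraction
  obtain ⟨Z, t, ht, hZ⟩ := hP ψ.Y'
  have h' : s₀ ≫ ψ.s = s ≫ ψ.f := h
  have hst : W (s₀ ≫ ψ.s ≫ t) := W.comp_mem _ _ hs₀ (W.comp_mem _ _ ψ.hs ht)
  have hst' : s ≫ ψ.f ≫ t = s₀ ≫ ψ.s ≫ t := by rw [reassoc_of% h']
  refine ⟨Z, _, hst, ψ.f ≫ t, ψ.s ≫ t, hst', rfl, ?_⟩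
  have := (isIso_toDerivedObj_iff _ hst).2 (hα _ hZ)
  -- Since `Z` satisfies `P`, the map `T(Z) ⟶ RT(X)` is invertible, and the equality can be checked
  -- in `RT(X)`, where it is the cocone property.
  rw [← cancel_mono (toDerivedObj α _ hst)]
  simp only [Category.assoc]
  rw [map_toDerivedObj s hs _ hst _ hst', map_toDerivedObj s₀ hs₀ _ hst _ rfl,
    IsIso.inv_hom_id, Category.comp_id]

/-- The morphism `α` of a total right derived functor is an isomorphism on any class of objects
which is large enough and such that `T` inverts the morphisms in `W` between its objects. -/
lemma IsTotalRightDerived.isIso_app [W.IsMultiplicative] (h : IsTotalRightDerived W RT α)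
    (hP : ∀ X, ∃ (Y : K) (s : X ⟶ Y), W s ∧ P Y)
    (hT : ∀ {X Y : K} (s : X ⟶ Y), W s → P X → P Y → IsIso (T.map s)) (X : K) (hX : P X) :
    IsIso (α.app X : T.obj X ⟶ RT.obj (L.obj X)) := by
  obtain ⟨Y₀, s₀, hs₀, σ, h1, h2⟩ := isTotalRightDerived_iff.1 h X
  -- Essential constancy is applied to the initial index `𝟙 X`. Enlarging `Z` to `Z'` satisfying `P`
  -- makes `T(X) ⟶ T(Z')` invertible.
  obtain ⟨Z, t, ht, a, b, ha, hb, hab⟩ := h2 X (𝟙 X) (W.id_mem X)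
  obtain ⟨Z', c, hc, hZ'⟩ := hP Z
  have htc : W (t ≫ c) := W.comp_mem _ _ ht hc
  obtain rfl : a = t := by simpa using ha
  have := hT _ htc hX hZ'
  have e1 : T.map (a ≫ c) = toDerivedObj α (𝟙 X) (W.id_mem X) ≫ σ ≫ T.map (b ≫ c) := by
    rw [T.map_comp, hab, T.map_comp]
    simp only [Category.assoc]
  have e2 : T.map (a ≫ c) ≫ toDerivedObj α _ htc = toDerivedObj α (𝟙 X) (W.id_mem X) :=
    map_toDerivedObj _ _ _ _ _ (by simp)
  have e3 : σ ≫ T.map (b ≫ c) ≫ toDerivedObj α _ htc = 𝟙 _ := by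
    rw [map_toDerivedObj s₀ hs₀ _ htc _ (by rw [reassoc_of% hb]), h1]
  rw [← isIso_toDerivedObj_iff (𝟙 X) (W.id_mem X)]
  -- The inverse of `T(X) ⟶ RT(X)` goes from `RT(X)` to `T(Z')` through `Y₀` and back to `T(X)`.
  refine ⟨σ ≫ T.map (b ≫ c) ≫ inv (T.map (a ≫ c)), ?_, ?_⟩
  · rw [← cancel_mono (T.map (a ≫ c))]
    simp only [Category.assoc, IsIso.inv_hom_id, Category.comp_id, Category.id_comp]
    exact e1.symm
  · rw [← e2]
    simp only [Category.assoc, IsIso.inv_hom_id_assoc]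
    exact e3

/-- A functor which has a total right derived functor is right derivable. -/
lemma IsTotalRightDerived.isRightDerivable (h : IsTotalRightDerived W RT α) :
    IsRightDerivable W T :=
  fun X => ⟨_, h X⟩

end DeligneFormal

/-! ### Projections from the total complex of a bounded below double complex -/

section TotalProjections

open ComplexShape HomologicalComplex₂

variable {D : Type*} [Category* D] [Abelian D] (M : HomologicalComplex₂ D (up ℤ) (up ℕ))
  [M.HasTotal (up ℤ)]

/-- The inclusion in the total complex of the summand of bidegree `(p, q)`. -/
def totι (p : ℤ) (q : ℕ) (n : ℤ) (h : p + q = n) : (M.X p).X q ⟶ (M.total (up ℤ)).X n :=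
  M.ιTotal (up ℤ) p q n h

/-- The projection from the total complex to the summand of bidegree `(p, q)`. -/
def totπ (p : ℤ) (q : ℕ) (n : ℤ) : (M.total (up ℤ)).X n ⟶ (M.X p).X q :=
  M.totalDesc fun p' q' _ =>
    if h : p' = p ∧ q' = q then (M.XXIsoOfEq _ _ _ h.1 h.2).hom else 0

variable {M}

lemma tot_hom_ext {A : D} {n : ℤ} {f g : (M.total (up ℤ)).X n ⟶ A}
    (h : ∀ (p : ℤ) (q : ℕ) (hpq : p + q = n),
      totι M p q n hpq ≫ f = totι M p q n hpq ≫ g) : f = g :=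
  total.hom_ext (up ℤ) h

lemma totι_π (p : ℤ) (q : ℕ) (n : ℤ) (h : p + q = n) :
    totι M p q n h ≫ totπ M p q n = 𝟙 _ := by
  rw [totι, totπ, ι_totalDesc, dif_pos ⟨rfl, rfl⟩]
  rfl

lemma totι_π_of_ne (p p' : ℤ) (q q' : ℕ) (n : ℤ) (h : p + q = n) (h' : p ≠ p') :
    totι M p q n h ≫ totπ M p' q' n = 0 := by
  rw [totι, totπ, ι_totalDesc, dif_neg (fun h'' => h' h''.1)]

lemma totι_π_of_ne' (p p' : ℤ) (q q' : ℕ) (n : ℤ) (h : p + q = n) (h' : q ≠ q') :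
    totι M p q n h ≫ totπ M p' q' n = 0 := by
  rw [totι, totπ, ι_totalDesc, dif_neg (fun h'' => h' h''.2)]

lemma totπ_eq_zero (p : ℤ) (q : ℕ) (n : ℤ) (h : p + q ≠ n) : totπ M p q n = 0 := by
  refine tot_hom_ext fun p₁ q₁ h₁ => ?_
  rw [comp_zero]
  by_cases hp : p₁ = p
  · exact totι_π_of_ne' _ _ _ _ _ _ (by lia)
  · exact totι_π_of_ne _ _ _ _ _ _ hp

lemma totι_d (p p' : ℤ) (q q' : ℕ) (n n' : ℤ) (h : p + q = n) (hp : p + 1 = p') (hq : q + 1 = q')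
    (hn : n + 1 = n') :
    totι M p q n h ≫ (M.total (up ℤ)).d n n' =
      (M.d p p').f q ≫ totι M p' q n' (by lia) +
        p.negOnePow • ((M.X p).d q q' ≫ totι M p q' n' (by lia)) := by
  rw [totι, total_d, Preadditive.comp_add, ι_D₁, ι_D₂,
    d₁_eq _ _ (show (up ℤ).Rel p p' from hp) _ _ (by simp; lia),
    d₂_eq _ _ _ (show (up ℕ).Rel q q' from hq) _ (by simp; lia)]
  rw [show ε₁ (up ℤ) (up ℕ) (up ℤ) (p, q) = 1 from rfl, one_smul]
  rfl

/-- A double complex which vanishes in the bidegrees `(p, q)` with `p < m`. -/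
def IsBoundedBelow (M : HomologicalComplex₂ D (up ℤ) (up ℕ)) (m : ℤ) : Prop :=
  ∀ p q, p < m → IsZero ((M.X p).X q)

omit [M.HasTotal (up ℤ)] in
lemma IsBoundedBelow.mono {m m' : ℤ} (hM : IsBoundedBelow M m) (h : m' ≤ m) :
    IsBoundedBelow M m' :=
  fun p q hp => hM p q (by lia)

/-- Bidegree `(n - q, q)` can be nonzero only for `q ≤ n - m`, so the coproduct in degree `n` is a
finite biproduct. This is what allows morphisms into the total complex to be tested and constructed
by components. -/
lemma tot_id {m : ℤ} (hM : IsBoundedBelow M m) (n : ℤ) (N : ℕ) (hN : n - m < N) :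
    𝟙 ((M.total (up ℤ)).X n) =
      ∑ q ∈ Finset.range N, totπ M (n - q) q n ≫ totι M (n - q) q n (by lia) := by
  refine tot_hom_ext fun p q h => ?_
  obtain rfl : p = n - q := by lia
  rw [Category.comp_id, Preadditive.comp_sum]
  by_cases hq : q < N
  · rw [Finset.sum_eq_single q]
    · rw [← Category.assoc, totι_π, Category.id_comp]
    · intro q' _ hq'
      rw [← Category.assoc, totι_π_of_ne _ _ _ _ _ _ (by lia), zero_comp]
    · intro h
      exact (h (by simpa using hq)).elim
  · exact (hM _ _ (by lia)).eq_of_src _ _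

lemma tot_hom_ext' {m : ℤ} (hM : IsBoundedBelow M m) {A : D} {n : ℤ}
    {f g : A ⟶ (M.total (up ℤ)).X n}
    (h : ∀ (p : ℤ) (q : ℕ), p + q = n → f ≫ totπ M p q n = g ≫ totπ M p q n) : f = g := by
  rw [← Category.comp_id f, ← Category.comp_id g, tot_id hM n ((n - m).toNat + 1) (by lia),
    Preadditive.comp_sum, Preadditive.comp_sum]
  refine Finset.sum_congr rfl fun q _ => ?_
  rw [← Category.assoc, ← Category.assoc, h _ _ (by lia)]

lemma totD_π_zero (p p' n n' : ℤ) (hp : p + 1 = p') (hn : n + 1 = n') (h : p = n) :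
    (M.total (up ℤ)).d n n' ≫ totπ M p' 0 n' = totπ M p 0 n ≫ (M.d p p').f 0 := by
  refine tot_hom_ext fun p₁ q₁ h₁ => ?_
  rw [← Category.assoc, totι_d p₁ _ q₁ _ n n' h₁ rfl rfl hn, Preadditive.add_comp,
    Linear.units_smul_comp]
  simp only [Category.assoc]
  rw [totι_π_of_ne p₁ p' (q₁ + 1) 0 n' _ (by lia), comp_zero, smul_zero, add_zero]
  by_cases hp₁ : p₁ = p
  · subst hp₁
    obtain rfl : q₁ = 0 := by lia
    subst hp
    rw [totι_π, Category.comp_id, ← Category.assoc, totι_π, Category.id_comp]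
  · rw [totι_π_of_ne _ _ _ _ _ _ (by lia), ← Category.assoc, totι_π_of_ne _ _ _ _ _ _ hp₁,
      zero_comp, comp_zero]

lemma totD_π_succ (p p' : ℤ) (q q' : ℕ) (n n' : ℤ) (hp : p + 1 = p') (hq : q + 1 = q')
    (hn : n + 1 = n') (h : p' + q = n) :
    (M.total (up ℤ)).d n n' ≫ totπ M p' q' n' =
      totπ M p q' n ≫ (M.d p p').f q' +
        p'.negOnePow • (totπ M p' q n ≫ (M.X p').d q q') := by
  refine tot_hom_ext fun p₁ q₁ h₁ => ?_
  have e1 : totι M p₁ q₁ n h₁ ≫ (M.total (up ℤ)).d n n' ≫ totπ M p' q' n' =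
      (M.d p₁ (p₁ + 1)).f q₁ ≫ totι M (p₁ + 1) q₁ n' (by lia) ≫ totπ M p' q' n' +
        p₁.negOnePow • ((M.X p₁).d q₁ (q₁ + 1) ≫ totι M p₁ (q₁ + 1) n' (by lia) ≫
          totπ M p' q' n') := by
    rw [← Category.assoc, totι_d p₁ _ q₁ _ n n' h₁ rfl rfl hn, Preadditive.add_comp,
      Linear.units_smul_comp, Category.assoc, Category.assoc]
  have e2 : totι M p₁ q₁ n h₁ ≫ (totπ M p q' n ≫ (M.d p p').f q' +
      p'.negOnePow • (totπ M p' q n ≫ (M.X p').d q q')) =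
      (totι M p₁ q₁ n h₁ ≫ totπ M p q' n) ≫ (M.d p p').f q' +
        p'.negOnePow • ((totι M p₁ q₁ n h₁ ≫ totπ M p' q n) ≫ (M.X p').d q q') := by
    rw [Preadditive.comp_add, Linear.comp_units_smul, Category.assoc, Category.assoc]
  rw [e1, e2]
  by_cases hp₁ : p₁ = p
  · subst hp₁
    obtain rfl : q₁ = q' := by lia
    subst hp
    rw [totι_π, Category.comp_id, totι_π, Category.id_comp, totι_π_of_ne _ _ _ _ _ _ (by lia),
      totι_π_of_ne _ _ _ _ _ _ (by lia), comp_zero, zero_comp, smul_zero, smul_zero]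
  · rw [totι_π_of_ne _ _ _ _ _ _ (show p₁ + 1 ≠ p' by lia), totι_π_of_ne _ _ _ _ _ _ hp₁,
      zero_comp, comp_zero]
    by_cases hp₂ : p₁ = p'
    · subst hp₂
      obtain rfl : q₁ = q := by lia
      subst hq
      rw [totι_π, totι_π, Category.comp_id, Category.id_comp]
    · rw [totι_π_of_ne _ _ _ _ _ _ hp₂, totι_π_of_ne _ _ _ _ _ _ hp₂, zero_comp, comp_zero,
        smul_zero, smul_zero]

/-- The differential of a family of elements which vanish in the rows of index `< q`. -/
lemma comp_totD_π_row {A : D} {n n' : ℤ} (y : A ⟶ (M.total (up ℤ)).X n) (p p' : ℤ) (q : ℕ)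
    (hp : p + 1 = p') (hn : n + 1 = n') (h : p + q = n)
    (hy : ∀ p' q', q' < q → y ≫ totπ M p' q' n = 0) :
    (y ≫ (M.total (up ℤ)).d n n') ≫ totπ M p' q n' = (y ≫ totπ M p q n) ≫ (M.d p p').f q := by
  rw [Category.assoc]
  obtain _ | q := q
  · rw [totD_π_zero p p' n n' hp hn (by simpa using h), Category.assoc]
  · rw [totD_π_succ p p' q (q + 1) n n' hp rfl hn (by lia), Preadditive.comp_add,
      Linear.comp_units_smul, ← Category.assoc y, ← Category.assoc y, hy p' q (by lia), zero_comp,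
      smul_zero, add_zero]

/-- The differential of a family of elements which vanish in the columns of index `< p`. -/
lemma comp_totD_π_column {A : D} {n n' : ℤ} (y : A ⟶ (M.total (up ℤ)).X n) (p : ℤ) (q q' : ℕ)
    (hq : q + 1 = q') (hn : n + 1 = n') (h : p + q = n)
    (hy : ∀ p' q', p' < p → y ≫ totπ M p' q' n = 0) :
    (y ≫ (M.total (up ℤ)).d n n') ≫ totπ M p q' n' =
      p.negOnePow • ((y ≫ totπ M p q n) ≫ (M.X p).d q q') := by
  rw [Category.assoc, totD_π_succ (p - 1) p q q' n n' (by lia) hq hn h, Preadditive.comp_add,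
    Linear.comp_units_smul, ← Category.assoc y, ← Category.assoc y, hy (p - 1) q' (by lia),
    zero_comp, zero_add]

lemma comp_totD_π_eq_zero {A : D} {n n' : ℤ} (y : A ⟶ (M.total (up ℤ)).X n) (p : ℤ) (q : ℕ)
    (hn : n + 1 = n') (h : p + q = n')
    (hy : ∀ p' q', p' ≤ p → y ≫ totπ M p' q' n = 0) :
    (y ≫ (M.total (up ℤ)).d n n') ≫ totπ M p q n' = 0 := by
  obtain _ | q := q
  · rw [Category.assoc, totD_π_zero (p - 1) p n n' (by lia) hn (by lia), ← Category.assoc,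
      hy _ _ (by lia), zero_comp]
  · rw [comp_totD_π_column y p q (q + 1) rfl hn (by lia) (fun p' q' h => hy p' q' (by lia)),
      hy _ _ (by lia), zero_comp, smul_zero]

variable {M' : HomologicalComplex₂ D (up ℤ) (up ℕ)} [M'.HasTotal (up ℤ)]

lemma totMap_π (φ : M ⟶ M') (p : ℤ) (q : ℕ) (n : ℤ) (h : p + q = n) :
    (total.map φ (up ℤ)).f n ≫ totπ M' p q n = totπ M p q n ≫ (φ.f p).f q := by
  refine tot_hom_ext fun p₁ q₁ h₁ => ?_
  have e : totι M p₁ q₁ n h₁ ≫ (total.map φ (up ℤ)).f n = (φ.f p₁).f q₁ ≫ totι M' p₁ q₁ n h₁ :=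
    ιTotal_map _ _ _ _ _ _ _ _
  rw [← Category.assoc, e, Category.assoc]
  by_cases hp : p₁ = p
  · subst hp
    obtain rfl : q₁ = q := by lia
    rw [totι_π, Category.comp_id, ← Category.assoc, totι_π, Category.id_comp]
  · rw [totι_π_of_ne _ _ _ _ _ _ hp, ← Category.assoc, totι_π_of_ne _ _ _ _ _ _ hp, zero_comp,
      comp_zero]

end TotalProjections

/-! ### Quasi-isomorphisms in terms of relative cycles -/

section RelativeCycles

open ComplexShape

variable {D : Type*} [Category* D] [Abelian D] {T T' : CochainComplex D ℤ}

/-- Every cycle of the mapping cone of `φ` is a boundary, up to refinements. -/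
def IsRelativelyExact (φ : T ⟶ T') : Prop :=
  ∀ ⦃i j k l : ℤ⦄, i + 1 = j → j + 1 = k → k + 1 = l → ∀ ⦃A : D⦄ (x : A ⟶ T.X k) (x' : A ⟶ T'.X j),
    x ≫ T.d k l = 0 → x ≫ φ.f k = x' ≫ T'.d j k →
    ∃ (A' : D) (π : A' ⟶ A) (_ : Epi π) (y : A' ⟶ T.X j) (y' : A' ⟶ T'.X i),
      π ≫ x = y ≫ T.d j k ∧ π ≫ x' = y ≫ φ.f j + y' ≫ T'.d i j

/-- Injectivity on `H^k` makes `x` a boundary; after subtracting the image of a primitive, `x'`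
becomes a cycle, and surjectivity on `H^j` handles it. Conversely, injectivity is the first
component of the conclusion and surjectivity is the case `x = 0`. The advantage is a single lifting
property that can be propagated along a filtration of a total complex. -/
lemma quasiIso_iff_isRelativelyExact (φ : T ⟶ T') : QuasiIso φ ↔ IsRelativelyExact φ := by
  have hprev (i j : ℤ) (h : i + 1 = j) : (up ℤ).prev j = i := by simp [← h]
  have hnext (i j : ℤ) (h : i + 1 = j) : (up ℤ).next i = j := by simp [← h]
  constructor
  · intro _ i j k l hi hj hk A x x' hx hxx'
    obtain ⟨A₁, π₁, _, y₁, hy₁⟩ :=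
      (HomologicalComplex.mono_homologyMap_iff_up_to_refinements φ j k l (hprev _ _ hj)
        (hnext _ _ hk)).1 inferInstance x hx x' hxx'
    obtain ⟨A₂, π₂, _, z, hz, y', h⟩ :=
      (HomologicalComplex.epi_homologyMap_iff_up_to_refinements φ i j k (hprev _ _ hi)
        (hnext _ _ hj)).1 inferInstance (π₁ ≫ x' - y₁ ≫ φ.f j) (by
          rw [Preadditive.sub_comp, Category.assoc, ← hxx', ← Category.assoc, hy₁]
          simp)
    refine ⟨A₂, π₂ ≫ π₁, inferInstance, π₂ ≫ y₁ + z, y', ?_, ?_⟩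
    · rw [Category.assoc, hy₁, Preadditive.add_comp, hz, add_zero, Category.assoc]
    · rw [Preadditive.comp_sub, sub_eq_iff_eq_add] at h
      rw [Category.assoc, h, Preadditive.add_comp, Category.assoc]
      abel
  · intro h
    rw [quasiIso_iff]
    intro j
    rw [quasiIsoAt_iff_isIso_homologyMap]
    have : Mono (HomologicalComplex.homologyMap φ j) := by
      rw [HomologicalComplex.mono_homologyMap_iff_up_to_refinements φ (j - 1) j (j + 1)
        (hprev _ _ (by lia)) (hnext _ _ rfl)]
      intro A x hx x' hxx'
      obtain ⟨A', π, hπ, y, _, hy, _⟩ :=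
        h (i := j - 1 - 1) (by lia) (by lia) rfl x x' hx hxx'
      exact ⟨A', π, hπ, y, hy⟩
    have : Epi (HomologicalComplex.homologyMap φ j) := by
      rw [HomologicalComplex.epi_homologyMap_iff_up_to_refinements φ (j - 1) j (j + 1)
        (hprev _ _ (by lia)) (hnext _ _ rfl)]
      intro A x' hx'
      obtain ⟨A', π, hπ, y, y', hy, hy'⟩ :=
        h (i := j - 1) (l := j + 1 + 1) (by lia) rfl rfl (0 : A ⟶ T.X (j + 1)) x'
          (by simp) (by simp [hx'])
      exact ⟨A', π, hπ, y, by simpa using hy.symm, y', hy'⟩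
    exact isIso_of_mono_of_epi _

end RelativeCycles

/-! ### Quasi-isomorphisms of total complexes -/

section TotalQuasiIso

open ComplexShape HomologicalComplex₂

variable {D : Type*} [Category* D] [Abelian D] {M M' : HomologicalComplex₂ D (up ℤ) (up ℕ)}
  [M.HasTotal (up ℤ)] [M'.HasTotal (up ℤ)]

lemma totι_totD_π_row_of_lt {A : D} (p p' : ℤ) (q q' : ℕ) (n n' : ℤ) (h : p + q = n)
    (hn : n + 1 = n') (v : A ⟶ (M.X p).X q) (hq : q' < q) :
    ((v ≫ totι M p q n h) ≫ (M.total (up ℤ)).d n n') ≫ totπ M p' q' n' = 0 := by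
  by_cases hp : p' + q' = n'
  · rw [comp_totD_π_row _ (p' - 1) p' q' (by lia) hn (by lia), Category.assoc v,
      totι_π_of_ne' _ _ _ _ _ _ (by lia), comp_zero, zero_comp]
    intro p₁ q₁ h₁
    rw [Category.assoc, totι_π_of_ne' _ _ _ _ _ _ (by lia), comp_zero]
  · rw [totπ_eq_zero _ _ _ hp, comp_zero]

lemma totι_totD_π_row {A : D} (p p' : ℤ) (q : ℕ) (n n' : ℤ) (h : p + q = n) (hp : p + 1 = p')
    (hn : n + 1 = n') (v : A ⟶ (M.X p).X q) :
    ((v ≫ totι M p q n h) ≫ (M.total (up ℤ)).d n n') ≫ totπ M p' q n' =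
      v ≫ (M.d p p').f q := by
  rw [comp_totD_π_row _ p p' q hp hn h, Category.assoc v, totι_π, Category.comp_id]
  intro p₁ q₁ h₁
  rw [Category.assoc, totι_π_of_ne' _ _ _ _ _ _ (by lia), comp_zero]

lemma totι_totMap_π {A : D} (φ : M ⟶ M') (p p' : ℤ) (q q' : ℕ) (n : ℤ) (h : p + q = n)
    (hq : q ≠ q') (v : A ⟶ (M.X p).X q) :
    ((v ≫ totι M p q n h) ≫ (total.map φ (up ℤ)).f n) ≫ totπ M' p' q' n = 0 := by
  by_cases hp : p' + q' = n
  · rw [Category.assoc, totMap_π _ _ _ _ hp, Category.assoc, ← Category.assoc (totι _ _ _ _ _),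
      totι_π_of_ne' _ _ _ _ _ _ hq, zero_comp, comp_zero]
  · rw [totπ_eq_zero _ _ _ hp, comp_zero]

/-- Induction on the number of rows in which the relative cycle `(x, x')` has been made zero by
subtracting a relative boundary. If it vanishes in the rows below `N`, only the horizontal
differential reaches row `N` of its coboundary, so its component there is a relative cycle of that
row. A primitive of this component, placed in row `N`, clears the row, and it does not disturb the
earlier ones because the total differential never lowers the row index. -/
lemma isRelativelyExact_totalMap_aux {φ : M ⟶ M'}
    (hφ : ∀ q, IsRelativelyExact
      (((HomologicalComplex.eval D (up ℕ) q).mapHomologicalComplex (up ℤ)).map φ))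
    {i j k l : ℤ} (hi : i + 1 = j) (hj : j + 1 = k) (hk : k + 1 = l) {A : D}
    (x : A ⟶ (M.total (up ℤ)).X k) (x' : A ⟶ (M'.total (up ℤ)).X j)
    (hx : x ≫ (M.total (up ℤ)).d k l = 0)
    (hxx' : x ≫ (total.map φ (up ℤ)).f k = x' ≫ (M'.total (up ℤ)).d j k) (N : ℕ) :
    ∃ (A' : D) (π : A' ⟶ A) (_ : Epi π) (y : A' ⟶ (M.total (up ℤ)).X j)
      (y' : A' ⟶ (M'.total (up ℤ)).X i),
      ∀ (p : ℤ) (q : ℕ), q < N →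
        (π ≫ x - y ≫ (M.total (up ℤ)).d j k) ≫ totπ M p q k = 0 ∧
        (π ≫ x' - (y ≫ (total.map φ (up ℤ)).f j + y' ≫ (M'.total (up ℤ)).d i j)) ≫
          totπ M' p q j = 0 := by
  induction N with
  | zero => exact ⟨A, 𝟙 A, inferInstance, 0, 0, fun p q hq => by lia⟩
  | succ N hN =>
    obtain ⟨A₁, π, _, y, y', h⟩ := hN
    set x₁ := π ≫ x - y ≫ (M.total (up ℤ)).d j k with hx₁
    set x₁' := π ≫ x' - (y ≫ (total.map φ (up ℤ)).f j + y' ≫ (M'.total (up ℤ)).d i j) with hx₁'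
    have h₁ : x₁ ≫ (M.total (up ℤ)).d k l = 0 := by simp [hx₁, hx]
    have h₂ : x₁ ≫ (total.map φ (up ℤ)).f k = x₁' ≫ (M'.total (up ℤ)).d j k := by
      simp [hx₁, hx₁', hxx', Preadditive.sub_comp]
    have h₃ : (x₁ ≫ totπ M (k - N) N k) ≫ (M.d (k - N) (l - N)).f N = 0 := by
      rw [← comp_totD_π_row x₁ (k - N) (l - N) N (by lia) hk (by lia) (fun p q hq => (h p q hq).1),
        h₁, zero_comp]
    have h₄ : (x₁ ≫ totπ M (k - N) N k) ≫ (φ.f (k - N)).f N =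
        (x₁' ≫ totπ M' (j - N) N j) ≫ (M'.d (j - N) (k - N)).f N := by
      rw [← comp_totD_π_row x₁' (j - N) (k - N) N (by lia) hj (by lia)
        (fun p q hq => (h p q hq).2), ← h₂, Category.assoc, Category.assoc,
        totMap_π _ _ _ _ (by lia)]
    have key : ∃ (A₂ : D) (π' : A₂ ⟶ A₁) (_ : Epi π') (v : A₂ ⟶ (M.X (j - N)).X N)
        (v' : A₂ ⟶ (M'.X (i - N)).X N),
        π' ≫ x₁ ≫ totπ M (k - N) N k = v ≫ (M.d (j - N) (k - N)).f N ∧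
        π' ≫ x₁' ≫ totπ M' (j - N) N j =
          v ≫ (φ.f (j - N)).f N + v' ≫ (M'.d (i - N) (j - N)).f N :=
      hφ N (i := i - N) (j := j - N) (k := k - N) (l := l - N)
        (by lia) (by lia) (by lia) (x₁ ≫ totπ M (k - N) N k) (x₁' ≫ totπ M' (j - N) N j) h₃ h₄
    obtain ⟨A₂, π', _, v, v', hv, hv'⟩ := key
    refine ⟨A₂, π' ≫ π, inferInstance, π' ≫ y + v ≫ totι M (j - N) N j (by lia),
      π' ≫ y' + v' ≫ totι M' (i - N) N i (by lia), fun p q hq => ?_⟩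
    have e₁ : (π' ≫ π) ≫ x - (π' ≫ y + v ≫ totι M (j - N) N j (by lia)) ≫
        (M.total (up ℤ)).d j k =
        π' ≫ x₁ - (v ≫ totι M (j - N) N j (by lia)) ≫ (M.total (up ℤ)).d j k := by
      simp only [hx₁, Preadditive.comp_sub, Preadditive.add_comp, Category.assoc]
      abel
    have e₂ : (π' ≫ π) ≫ x' - ((π' ≫ y + v ≫ totι M (j - N) N j (by lia)) ≫
        (total.map φ (up ℤ)).f j + (π' ≫ y' + v' ≫ totι M' (i - N) N i (by lia)) ≫
          (M'.total (up ℤ)).d i j) =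
        π' ≫ x₁' - ((v ≫ totι M (j - N) N j (by lia)) ≫ (total.map φ (up ℤ)).f j +
          (v' ≫ totι M' (i - N) N i (by lia)) ≫ (M'.total (up ℤ)).d i j) := by
      simp only [hx₁', Preadditive.comp_sub, Preadditive.add_comp, Preadditive.comp_add,
        Category.assoc]
      abel
    rw [e₁, e₂]
    simp only [Preadditive.sub_comp, Preadditive.add_comp]
    by_cases hqN : q < N
    · rw [totι_totD_π_row_of_lt _ _ _ _ _ _ _ hj _ hqN,
        totι_totD_π_row_of_lt _ _ _ _ _ _ _ hi _ hqN,
        totι_totMap_π _ _ _ _ _ _ _ (by lia), Category.assoc, Category.assoc, (h p q hqN).1,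
        (h p q hqN).2]
      simp
    · obtain rfl : q = N := by lia
      constructor
      · by_cases hp : p = k - q
        · subst hp
          rw [totι_totD_π_row _ _ _ _ _ _ (by lia) hj, Category.assoc, hv, sub_self]
        · rw [totπ_eq_zero _ _ _ (by lia)]
          simp
      · by_cases hp : p = j - q
        · subst hp
          rw [totι_totD_π_row _ _ _ _ _ _ (by lia) hi, Category.assoc, hv',
            Category.assoc _ _ (totπ _ _ _ _),
            totMap_π _ _ _ _ (by lia), Category.assoc, ← Category.assoc (totι _ _ _ _ _), totι_π,
            Category.id_comp, sub_self]
        · rw [totπ_eq_zero _ _ _ (by lia)]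
          simp

/-- A morphism of double complexes which is a quasi-isomorphism on every row induces a
quasi-isomorphism on total complexes. -/
lemma quasiIso_totalMap_of_rows {m : ℤ} (hM : IsBoundedBelow M m) (hM' : IsBoundedBelow M' m)
    (φ : M ⟶ M') (hφ : ∀ q, QuasiIso
      (((HomologicalComplex.eval D (up ℕ) q).mapHomologicalComplex (up ℤ)).map φ)) :
    QuasiIso (total.map φ (up ℤ)) := by
  rw [quasiIso_iff_isRelativelyExact]
  intro i j k l hi hj hk A x x' hx hxx'
  obtain ⟨A', π, hπ, y, y', h⟩ := isRelativelyExact_totalMap_aux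
    (fun q => (quasiIso_iff_isRelativelyExact _).1 (hφ q)) hi hj hk x x' hx hxx'
    ((k - m).toNat + 1)
  -- In total degree `n ≤ k`, a row index `q > k - m` forces `p = n - q < m`, where both double
  -- complexes vanish. So the rows cleared so far are all that matter.
  have h' {n : ℤ} (hn : n ≤ k) (p : ℤ) (q : ℕ) (hpq : p + q = n)
      (hq : ¬ q < (k - m).toNat + 1) : p < m := by lia
  refine ⟨A', π, hπ, y, y', ?_, ?_⟩
  · rw [← sub_eq_zero]
    refine tot_hom_ext' hM fun p q hpq => ?_
    rw [zero_comp]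
    by_cases hq : q < (k - m).toNat + 1
    · exact (h p q hq).1
    · exact (hM _ _ (h' le_rfl p q hpq hq)).eq_of_tgt _ _
  · rw [← sub_eq_zero]
    refine tot_hom_ext' hM' fun p q hpq => ?_
    rw [zero_comp]
    by_cases hq : q < (k - m).toNat + 1
    · exact (h p q hq).2
    · exact (hM' _ _ (h' (by lia) p q hpq hq)).eq_of_tgt _ _

end TotalQuasiIso

/-! ### Coresolutions and total complexes -/

section Coresolutions

open ComplexShape HomologicalComplex₂

variable {D : Type*} [Category* D] [Abelian D]

/-- The sequence `0 ⟶ X ⟶ Y^0 ⟶ Y^1 ⟶ ⋯` is exact (up to refinements). -/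
structure IsCoresolution {X : D} (Y : CochainComplex D ℕ) (a : X ⟶ Y.X 0) : Prop where
  mono : Mono a
  exact_zero {A : D} (x : A ⟶ Y.X 0) (hx : x ≫ Y.d 0 1 = 0) :
    ∃ (A' : D) (π : A' ⟶ A) (_ : Epi π) (y : A' ⟶ X), π ≫ x = y ≫ a
  exact_succ (q : ℕ) {A : D} (x : A ⟶ Y.X (q + 1)) (hx : x ≫ Y.d (q + 1) (q + 2) = 0) :
    ∃ (A' : D) (π : A' ⟶ A) (_ : Epi π) (y : A' ⟶ Y.X q), π ≫ x = y ≫ Y.d q (q + 1)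

variable {M : HomologicalComplex₂ D (up ℤ) (up ℕ)} [M.HasTotal (up ℤ)]

lemma totι_totD_π_column_of_lt {A : D} (p p' : ℤ) (q q' : ℕ) (n n' : ℤ) (h : p + q = n)
    (hn : n + 1 = n') (v : A ⟶ (M.X p).X q) (hp : p' < p) :
    ((v ≫ totι M p q n h) ≫ (M.total (up ℤ)).d n n') ≫ totπ M p' q' n' = 0 := by
  by_cases hp : p' + q' = n'
  · refine comp_totD_π_eq_zero _ p' q' hn hp fun p₁ q₁ h₁ => ?_
    rw [Category.assoc, totι_π_of_ne _ _ _ _ _ _ (by lia), comp_zero]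
  · rw [totπ_eq_zero _ _ _ hp, comp_zero]

lemma totι_totD_π_column {A : D} (p : ℤ) (q q' : ℕ) (n n' : ℤ) (h : p + q = n) (hq : q + 1 = q')
    (hn : n + 1 = n') (v : A ⟶ (M.X p).X q) :
    ((v ≫ totι M p q n h) ≫ (M.total (up ℤ)).d n n') ≫ totπ M p q' n' =
      p.negOnePow • (v ≫ (M.X p).d q q') := by
  rw [comp_totD_π_column _ p q q' hq hn h, Category.assoc v, totι_π, Category.comp_id]
  intro p₁ q₁ h₁
  rw [Category.assoc, totι_π_of_ne _ _ _ _ _ _ (by lia), comp_zero]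

/-- The columns are cleared from the left. Once those before `p` are zero, the component of `x'` in
column `p` is a vertical cycle. Because `p < j`, its row index `j - p` is positive, and exactness of
the column provides a primitive. The bound `m + N ≤ j` stops the process before row `0`, where
exactness is not assumed. -/
lemma column_filtration_step {m : ℤ}
    (hex : ∀ (p : ℤ) (q : ℕ) {A : D} (x : A ⟶ (M.X p).X (q + 1)),
      x ≫ (M.X p).d (q + 1) (q + 2) = 0 →
      ∃ (A' : D) (π : A' ⟶ A) (_ : Epi π) (y : A' ⟶ (M.X p).X q), π ≫ x = y ≫ (M.X p).d q (q + 1))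
    (hM : IsBoundedBelow M m)
    {i j k : ℤ} (hi : i + 1 = j) (hj : j + 1 = k) {A : D} (x' : A ⟶ (M.total (up ℤ)).X j)
    (hx' : ∀ (p : ℤ) (q : ℕ), p ≤ j → (x' ≫ (M.total (up ℤ)).d j k) ≫ totπ M p q k = 0)
    (N : ℕ) (hN : m + N ≤ j) :
    ∃ (A' : D) (π : A' ⟶ A) (_ : Epi π) (y' : A' ⟶ (M.total (up ℤ)).X i),
      ∀ (p : ℤ) (q : ℕ), p < m + N →
        (π ≫ x' - y' ≫ (M.total (up ℤ)).d i j) ≫ totπ M p q j = 0 := by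
  induction N with
  | zero =>
    exact ⟨A, 𝟙 A, inferInstance, 0, fun p q hp => (hM p q (by simpa using hp)).eq_of_tgt _ _⟩
  | succ N hrec =>
    obtain ⟨A₁, π, _, y', h⟩ := hrec (by lia)
    obtain ⟨q, hq⟩ : ∃ q : ℕ, m + N + (q + 1 : ℕ) = j := ⟨(j - m - N).toNat - 1, by lia⟩
    generalize hp₀ : m + N = p at *
    set x₁ := π ≫ x' - y' ≫ (M.total (up ℤ)).d i j with hx₁
    have h₁ (p : ℤ) (q : ℕ) (hp : p ≤ j) : (x₁ ≫ (M.total (up ℤ)).d j k) ≫ totπ M p q k = 0 := by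
      have : x₁ ≫ (M.total (up ℤ)).d j k = π ≫ x' ≫ (M.total (up ℤ)).d j k := by simp [hx₁]
      rw [this, Category.assoc, hx' p q hp, comp_zero]
    have h₂ : (x₁ ≫ totπ M p (q + 1) j) ≫ (M.X p).d (q + 1) (q + 2) = 0 := by
      have := h₁ p (q + 2) (by lia)
      rwa [comp_totD_π_column x₁ p (q + 1) (q + 2) rfl hj hq h, smul_eq_zero_iff_eq] at this
    obtain ⟨A₂, π', _, v, hv⟩ := hex p q _ h₂
    -- The factor `(-1)^p` cancels the sign of the vertical differential in the total complex.
    refine ⟨A₂, π' ≫ π, inferInstance, π' ≫ y' + p.negOnePow • (v ≫ totι M p q i (by lia)),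
      fun p' q' hp' => ?_⟩
    have e₁ : (π' ≫ π) ≫ x' - (π' ≫ y' + p.negOnePow • (v ≫ totι M p q i (by lia))) ≫
        (M.total (up ℤ)).d i j =
        π' ≫ x₁ - p.negOnePow • ((v ≫ totι M p q i (by lia)) ≫ (M.total (up ℤ)).d i j) := by
      simp only [hx₁, Preadditive.comp_sub, Preadditive.add_comp, Category.assoc,
        Linear.units_smul_comp]
      abel
    rw [e₁, Preadditive.sub_comp, Linear.units_smul_comp]
    by_cases hpp' : p' < p
    · rw [totι_totD_π_column_of_lt _ _ _ _ _ _ _ hi _ hpp', Category.assoc, h p' q' hpp']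
      simp
    · obtain rfl : p' = p := by push_cast at hp'; lia
      by_cases hq' : q' = q + 1
      · subst hq'
        rw [totι_totD_π_column _ _ _ _ _ _ rfl hi, Category.assoc, hv, smul_smul,
          Int.units_mul_self, one_smul, sub_self]
      · rw [totπ_eq_zero _ _ _ (by lia)]
        simp

/-- A morphism to the total complex of a double complex, the columns of which are coresolutions of
the terms of the source, is a quasi-isomorphism. -/
lemma quasiIso_of_columns {m : ℤ} (hM : IsBoundedBelow M m) {T : CochainComplex D ℤ}
    (φ : T ⟶ M.total (up ℤ)) (a : ∀ n, T.X n ⟶ (M.X n).X 0)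
    (hφ : ∀ n, φ.f n = a n ≫ totι M n 0 n (by simp)) (ha : ∀ n, IsCoresolution (M.X n) (a n)) :
    QuasiIso φ := by
  rw [quasiIso_iff_isRelativelyExact]
  intro i j k l hi hj hk A x x' hx hxx'
  have hφπ (n : ℤ) : φ.f n ≫ totπ M n 0 n = a n := by
    rw [hφ, Category.assoc, totι_π, Category.comp_id]
  -- The coboundary of `x'` is the image of `x`, which is concentrated in bidegree `(k, 0)`.
  have hx' (p : ℤ) (q : ℕ) (hp : p ≤ j) :
      (x' ≫ (M.total (up ℤ)).d j k) ≫ totπ M p q k = 0 := by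
    rw [← hxx', hφ, Category.assoc, Category.assoc, totι_π_of_ne _ _ _ _ _ _ (by lia), comp_zero,
      comp_zero]
  -- Lowering the bound to `min m j` allows exactly the columns `p < j` to be cleared, also when `j
  -- < m`. What remains of `x'` lies in bidegree `(j, 0)`, is a vertical cycle, and hence comes from
  -- `T.X j`.
  obtain ⟨A₁, π, _, y', h⟩ := column_filtration_step (fun p q A x hx => (ha p).exact_succ q x hx)
    (hM.mono (min_le_left m j)) hi hj x' hx' (j - min m j).toNat (by lia)
  set x₁ := π ≫ x' - y' ≫ (M.total (up ℤ)).d i j with hx₁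
  have h₁ : x₁ ≫ (M.total (up ℤ)).d j k = π ≫ x' ≫ (M.total (up ℤ)).d j k := by simp [hx₁]
  have h₂ : (x₁ ≫ totπ M j 0 j) ≫ (M.X j).d 0 1 = 0 := by
    have : (x₁ ≫ (M.total (up ℤ)).d j k) ≫ totπ M j 1 k = 0 := by
      rw [h₁, Category.assoc, hx' _ _ le_rfl, comp_zero]
    rwa [comp_totD_π_column x₁ j 0 1 rfl hj (by simp) (fun p q hp => h p q (by lia)),
      smul_eq_zero_iff_eq] at this
  obtain ⟨A₂, π', _, y, hy⟩ := (ha j).exact_zero _ h₂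
  have h₃ : π' ≫ x₁ = y ≫ φ.f j := by
    refine tot_hom_ext' hM fun p q hpq => ?_
    by_cases hp : p < j
    · rw [Category.assoc, h p q (by lia), hφ, Category.assoc, Category.assoc,
        totι_π_of_ne _ _ _ _ _ _ (by lia), comp_zero, comp_zero, comp_zero]
    · obtain rfl : q = 0 := by lia
      obtain rfl : p = j := by lia
      rw [Category.assoc, hy, Category.assoc, hφπ]
  -- The equation for `x` holds after applying `φ`, and `φ.f k` followed by the projection to
  -- bidegree `(k, 0)` is the monomorphism `a k`.
  have := (ha k).mono
  refine ⟨A₂, π' ≫ π, inferInstance, y, π' ≫ y', ?_, ?_⟩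
  · rw [← cancel_mono (a k), ← hφπ k]
    simp only [← Category.assoc]
    congr 1
    rw [Category.assoc, hxx', Category.assoc y, ← φ.comm, ← Category.assoc y, ← h₃,
      Category.assoc π', Category.assoc π', h₁]
  · rw [← h₃]
    simp [hx₁]

end Coresolutions

/-! ### Derived functors from a functor which inverts quasi-isomorphisms -/

section FormalDerived

variable {K₀ K E D : Type*} [Category* K₀] [Category* K] [Category* E] [Category* D]

/-- Two functors `T` and `S` which receive morphisms from the same functor `G` are isomorphic if
these morphisms are isomorphisms on the image of an endofunctor `I`, and `T` and `S` invert a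
natural morphism `𝟭 ⟶ I`. -/
lemma exists_iso_of_isIso_on_image {G T S : K₀ ⥤ E} (η : G ⟶ T) (a : G ⟶ S) (I : K₀ ⥤ K₀)
    (j : 𝟭 K₀ ⟶ I) (hT : ∀ X, IsIso (T.map (j.app X))) (hS : ∀ X, IsIso (S.map (j.app X)))
    (hη : ∀ X, IsIso (η.app (I.obj X))) (ha : ∀ X, IsIso (a.app (I.obj X))) :
    ∃ e : T ≅ S, η ≫ e.hom = a := by
  have hj {X Y : K₀} (f : X ⟶ Y) : f ≫ j.app Y = j.app X ≫ I.map f := j.naturality f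
  -- The isomorphism is the composite `T(X) ≅ T(I(X)) ≅ G(I(X)) ≅ S(I(X)) ≅ S(X)`.
  refine ⟨NatIso.ofComponents (fun X => asIso (T.map (j.app X)) ≪≫ (asIso (η.app (I.obj X))).symm ≪≫
    asIso (a.app (I.obj X)) ≪≫ (asIso (S.map (j.app X))).symm) (fun {X Y} f => ?_), ?_⟩
  · dsimp
    have h1 : inv (η.app (I.obj X)) ≫ G.map (I.map f) =
        T.map (I.map f) ≫ inv (η.app (I.obj Y)) := by
      rw [IsIso.inv_comp_eq, ← Category.assoc, ← η.naturality, Category.assoc, IsIso.hom_inv_id,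
        Category.comp_id]
    have h2 : inv (S.map (j.app X)) ≫ S.map f = S.map (I.map f) ≫ inv (S.map (j.app Y)) := by
      rw [IsIso.inv_comp_eq, ← Category.assoc, ← S.map_comp, ← hj, S.map_comp, Category.assoc,
        IsIso.hom_inv_id, Category.comp_id]
    rw [← Category.assoc (T.map f), ← T.map_comp, hj, T.map_comp]
    simp only [Category.assoc]
    rw [h2, ← a.naturality_assoc, reassoc_of% h1]
  · ext X
    dsimp
    rw [← η.naturality_assoc, IsIso.hom_inv_id_assoc, a.naturality_assoc, IsIso.hom_inv_id]
    exact Category.comp_id _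

variable {W : MorphismProperty K} [W.HasLeftCalculusOfFractions] {L : K ⥤ D} [L.IsLocalization W]
  {W₀ : MorphismProperty K₀} {q : K₀ ⥤ K} [q.IsLocalization W₀] [q.Full]
  {G : K ⥤ E} {T : K₀ ⥤ E} (η : q ⋙ G ⟶ T) (I : K₀ ⥤ K₀) (j : 𝟭 K₀ ⟶ I)

-- In the application `q` is `C⁺ ⥤ K⁺`, with `W₀` the homotopy equivalences. Since `T` inverts `W`,
-- it descends first to `K`, together with `η`, and then to `D`. The descended `η` is an isomorphism
-- on the objects `I(X)`, so `isTotalRightDerived_of_isIso` applies to them.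
include W₀ in
lemma exists_isTotalRightDerived (hq : Function.Surjective q.obj) (hW₀ : W₀ ≤ W.inverseImage q)
    (hT : (W.inverseImage q).IsInvertedBy T) (hj : ∀ X, W (q.map (j.app X)))
    (hη : ∀ X, IsIso (η.app (I.obj X))) :
    ∃ (RT : D ⥤ E) (α : G ⟶ L ⋙ RT), IsTotalRightDerived W RT α := by
  have hT₀ : W₀.IsInvertedBy T := fun X Y f hf => hT f (hW₀ _ hf)
  let T' : K ⥤ E := Localization.lift T hT₀ q
  have hT' : W.IsInvertedBy T' := fun X Y f hf => by
    obtain ⟨X, rfl⟩ := hq X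
    obtain ⟨Y, rfl⟩ := hq Y
    obtain ⟨f, rfl⟩ := q.map_surjective f
    have := hT f hf
    exact ((MorphismProperty.isomorphisms E).arrow_mk_iso_iff
      (((Functor.mapArrowFunctor _ _).mapIso (Localization.fac T hT₀ q)).app (Arrow.mk f))).2 this
  let β : G ⟶ T' := Localization.liftNatTrans q W₀ (q ⋙ G) T G T' η
  have hβ (X : K₀) [IsIso (η.app X)] : IsIso (β.app (q.obj X)) := by
    have : β.app (q.obj X) = _ := Localization.liftNatTrans_app q W₀ (q ⋙ G) T G T' η X
    rw [this]
    infer_instance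
  refine ⟨Localization.lift T' hT' L, β ≫ (Localization.fac T' hT' L).inv,
    isTotalRightDerived_of_isIso (P := fun X => ∃ Y, X = q.obj (I.obj Y)) (fun X => ?_) ?_⟩
  · obtain ⟨X, rfl⟩ := hq X
    exact ⟨_, q.map (j.app X), hj X, X, rfl⟩
  · rintro _ ⟨Y, rfl⟩
    have := hη Y
    have := hβ (I.obj Y)
    exact inferInstanceAs (IsIso (β.app _ ≫ (Localization.fac T' hT' L).inv.app _))

/-- On the objects `I(X)` the functor `G` agrees with `T` through `η`, so it inverts the morphisms
in `W` between them. Hence `α` is an isomorphism there, and both `η` and `α` can serve in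
`exists_iso_of_isIso_on_image`. -/
lemma exists_iso_of_isTotalRightDerived {RT : D ⥤ E} {α : G ⟶ L ⋙ RT}
    (h : IsTotalRightDerived W RT α) (hq : Function.Surjective q.obj)
    (hT : (W.inverseImage q).IsInvertedBy T) (hj : ∀ X, W (q.map (j.app X)))
    (hη : ∀ X, IsIso (η.app (I.obj X))) :
    ∃ e : T ≅ q ⋙ L ⋙ RT, η ≫ e.hom = Functor.whiskerLeft q α := by
  refine exists_iso_of_isIso_on_image η (Functor.whiskerLeft q α) I j (fun X => hT _ (hj X))
    (fun X => ?_) hη (fun X => ?_)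
  · have := Localization.inverts L W _ (hj X)
    exact inferInstanceAs (IsIso (RT.map (L.map (q.map (j.app X)))))
  · refine h.isIso_app (P := fun X => ∃ Y, X = q.obj (I.obj Y)) (fun X => ?_) ?_ _ ⟨X, rfl⟩
    · obtain ⟨X, rfl⟩ := hq X
      exact ⟨_, q.map (j.app X), hj X, X, rfl⟩
    · rintro _ _ s hs ⟨X, rfl⟩ ⟨Y, rfl⟩
      obtain ⟨f, rfl⟩ := q.map_surjective s
      have := hη X
      have := hη Y
      have := hT f hs
      have e : G.map (q.map f) = η.app (I.obj X) ≫ T.map f ≫ inv (η.app (I.obj Y)) := by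
        have := η.naturality f
        dsimp at this
        rw [← reassoc_of% this, IsIso.hom_inv_id, Category.comp_id]
      rw [e]
      infer_instance

end FormalDerived

/-! ### Derived functors from exact complex valued functors -/

section ComplexValuedFunctors

open ComplexShape

variable {C D : Type*} [Category* C] [Category* D] [Abelian C] [Abelian D]

/-- The coaugmentation identifies `F(X)` with the degree zero cohomology of `R(X)`, and the other
cohomology objects of `R(X)` vanish. -/
def IsAcyclicFor {F : C ⥤ D} {R : C ⥤ CochainComplex D ℕ}
    (η : F ⟶ R ⋙ HomologicalComplex.eval D (up ℕ) 0) (X : C) : Prop :=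
  IsCoresolution (R.obj X) (η.app X : F.obj X ⟶ (R.obj X).X 0)

lemma IsCoresolution.of_retract {X X' : D} {Y Y' : CochainComplex D ℕ} {a : X ⟶ Y.X 0}
    {a' : X' ⟶ Y'.X 0} (i : X ⟶ X') (r : X' ⟶ X) (iY : Y ⟶ Y') (rY : Y' ⟶ Y)
    (hX : i ≫ r = 𝟙 X) (hY : iY ≫ rY = 𝟙 Y) (hi : i ≫ a' = a ≫ iY.f 0) (hr : r ≫ a = a' ≫ rY.f 0)
    (h : IsCoresolution Y' a') : IsCoresolution Y a := by
  have hY' (q : ℕ) : iY.f q ≫ rY.f q = 𝟙 _ := by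
    rw [← HomologicalComplex.comp_f, hY, HomologicalComplex.id_f]
  refine ⟨?_, fun x hx => ?_, fun q A x hx => ?_⟩
  · have := h.mono
    have : Mono i := mono_of_mono_fac hX
    have : Mono (a ≫ iY.f 0) := by
      rw [← hi]
      infer_instance
    exact mono_of_mono a (iY.f 0)
  · obtain ⟨A', π, hπ, y, hy⟩ := h.exact_zero (x ≫ iY.f 0) (by
      rw [Category.assoc, iY.comm, reassoc_of% hx, zero_comp])
    refine ⟨A', π, hπ, y ≫ r, ?_⟩
    rw [Category.assoc, hr, ← Category.assoc y, ← hy, Category.assoc, Category.assoc, hY',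
      Category.comp_id]
  · obtain ⟨A', π, hπ, y, hy⟩ := h.exact_succ q (x ≫ iY.f (q + 1)) (by
      rw [Category.assoc, iY.comm, reassoc_of% hx, zero_comp])
    refine ⟨A', π, hπ, y ≫ rY.f q, ?_⟩
    rw [Category.assoc, rY.comm, ← Category.assoc y, ← hy, Category.assoc, Category.assoc,
      hY', Category.comp_id]

omit [Abelian C] in
/-- A retract of an acyclic object is acyclic. -/
lemma IsAcyclicFor.of_retract {F : C ⥤ D} {R : C ⥤ CochainComplex D ℕ}
    {η : F ⟶ R ⋙ HomologicalComplex.eval D (up ℕ) 0} {X Y : C} (i : X ⟶ Y) (r : Y ⟶ X)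
    (hir : i ≫ r = 𝟙 X) (hY : IsAcyclicFor η Y) : IsAcyclicFor η X :=
  IsCoresolution.of_retract (F.map i) (F.map r) (R.map i) (R.map r)
    (by rw [← F.map_comp, hir, F.map_id]) (by rw [← R.map_comp, hir, R.map_id])
    (η.naturality i) (η.naturality r) hY

variable (R : C ⥤ CochainComplex D ℕ) [R.PreservesZeroMorphisms]

lemma exists_isBoundedBelow_doubleComplex (K : CochainComplex.Plus C) :
    ∃ m, IsBoundedBelow (doubleComplex R K.obj) m := by
  obtain ⟨m, hm⟩ := K.property
  exact ⟨m, fun p q hp => isZero_doubleComplex R _ _ (K.obj.isZero_of_isStrictlyGE m _ hp) q⟩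

/-- The extension of an exact complex valued functor to bounded below complexes preserves
quasi-isomorphisms. -/
lemma quasiIso_totPlus_map [PreservesFiniteLimits R] [PreservesFiniteColimits R]
    {K L : CochainComplex.Plus C} (f : K ⟶ L) (hf : QuasiIso f.hom) :
    QuasiIso ((totPlus R).map f).hom := by
  obtain ⟨m, hm⟩ := exists_isBoundedBelow_doubleComplex R K
  obtain ⟨m', hm'⟩ := exists_isBoundedBelow_doubleComplex R L
  refine quasiIso_totalMap_of_rows (hm.mono (min_le_left m m')) (hm'.mono (min_le_right m m')) _
    fun q => ?_
  -- Row `q` of the double complex is the exact functor `R^q` applied termwise to `K`.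
  have : (R ⋙ HomologicalComplex.eval D (up ℕ) q).PreservesHomology :=
    Functor.preservesHomologyOfExact _
  have : (R ⋙ HomologicalComplex.eval D (up ℕ) q).Additive :=
    Functor.additive_of_preserves_binary_products _
  exact HomologicalComplex.quasiIso_map_of_preservesHomology
    (φ := f.hom) (F := R ⋙ HomologicalComplex.eval D (up ℕ) q) (hφ := hf)

variable {R} {F : C ⥤ D} [F.PreservesZeroMorphisms]
  (η : F ⟶ R ⋙ HomologicalComplex.eval D (up ℕ) 0) (hη : ∀ X, η.app X ≫ (R.obj X).d 0 1 = 0)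

lemma quasiIso_totCoaugmentation (K : CochainComplex.Plus C)
    (hK : ∀ n, IsAcyclicFor η (K.obj.X n)) :
    QuasiIso ((totCoaugmentation F η hη).app K).hom := by
  obtain ⟨m, hm⟩ := exists_isBoundedBelow_doubleComplex R K
  exact quasiIso_of_columns hm _ (fun n => η.app (K.obj.X n)) (fun n => rfl) hK

end ComplexValuedFunctors

/-! ### Passage to the bounded below derived categories -/

section DerivedComplexValued

open ComplexShape

variable {C D : Type*} [Category* C] [Category* D] [Abelian C] [Abelian D]


/-- Quasi-isomorphisms are the morphisms whose cone lies in the triangulated subcategory of acyclic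
complexes. -/
instance : (HomotopyCategory.Plus.quasiIso C).HasLeftCalculusOfFractions := by
  rw [HomotopyCategory.Plus.quasiIso_eq_subcategoryAcyclic_trW]
  infer_instance

lemma quasiIso_quotient_map_iff {K L : CochainComplex.Plus C} (f : K ⟶ L) :
    HomotopyCategory.Plus.quasiIso C ((HomotopyCategory.Plus.quotient C).map f) ↔
      QuasiIso f.hom :=
  HomotopyCategory.quotient_map_mem_quasiIso_iff f.hom

variable [HasDerivedCategory D]

lemma isIso_Q_map {K L : CochainComplex.Plus D} (f : K ⟶ L) (hf : QuasiIso f.hom) :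
    IsIso (DerivedCategory.Plus.Q.map f) :=
  Localization.inverts DerivedCategory.Plus.Qh (HomotopyCategory.Plus.quasiIso D) _
    ((quasiIso_quotient_map_iff f).2 hf)

lemma isInvertedBy_totPlus_Q (R : C ⥤ CochainComplex D ℕ) [R.PreservesZeroMorphisms]
    [PreservesFiniteLimits R] [PreservesFiniteColimits R] :
    ((HomotopyCategory.Plus.quasiIso C).inverseImage
      (HomotopyCategory.Plus.quotient C)).IsInvertedBy (totPlus R ⋙ DerivedCategory.Plus.Q) :=
  fun _ _ f hf => isIso_Q_map _ (quasiIso_totPlus_map R f ((quasiIso_quotient_map_iff f).1 hf))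

variable {R : C ⥤ CochainComplex D ℕ} [R.PreservesZeroMorphisms] {F : C ⥤ D} [F.Additive]
  (η : F ⟶ R ⋙ HomologicalComplex.eval D (up ℕ) 0)
  (hη : ∀ X, η.app X ≫ (R.obj X).d 0 1 = 0)
  (I : CochainComplex.Plus C ⥤ CochainComplex.Plus C) (j : 𝟭 _ ⟶ I)

/-- The coaugmentation `F(K) ⟶ R(K)` in the derived category. -/
def derivedCoaugmentation :
    HomotopyCategory.Plus.quotient C ⋙ toDerivedPlus F ⟶ totPlus R ⋙ DerivedCategory.Plus.Q :=
  (mapPlusIso F).inv ≫ Functor.whiskerRight (totCoaugmentation F η hη) DerivedCategory.Plus.Q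

lemma isIso_derivedCoaugmentation_app
    (hI : ∀ K n, IsAcyclicFor η ((I.obj K).obj.X n)) (K : CochainComplex.Plus C) :
    IsIso ((derivedCoaugmentation η hη).app (I.obj K)) := by
  have := isIso_Q_map _ (quasiIso_totCoaugmentation η hη (I.obj K) (hI K))
  exact inferInstanceAs (IsIso ((mapPlusIso F).inv.app _ ≫ DerivedCategory.Plus.Q.map
    ((totCoaugmentation F η hη).app (I.obj K))))

variable [HasDerivedCategory C]

include hη in
/-- A functor `F` has a total right derived functor if there are an exact complex valued functor
coaugmented by `F` and functorial resolutions by complexes of objects which are acyclic for it. -/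
lemma exists_isTotalRightDerivedPlus [PreservesFiniteLimits R] [PreservesFiniteColimits R]
    (hj : ∀ K, QuasiIso (j.app K).hom) (hI : ∀ K n, IsAcyclicFor η ((I.obj K).obj.X n)) :
    ∃ (RF : DerivedCategory.Plus C ⥤ DerivedCategory.Plus D)
      (α : toDerivedPlus F ⟶ DerivedCategory.Plus.Qh ⋙ RF), IsTotalRightDerivedPlus F RF α :=
  exists_isTotalRightDerived
    (W₀ := (HomologicalComplex.homotopyEquivalences C (up ℤ)).inverseImage
      (CochainComplex.Plus.ι C))
    (derivedCoaugmentation η hη) I j HomotopyCategory.Plus.quotient_obj_surjective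
    (fun _ _ f hf => (quasiIso_quotient_map_iff f).2
      (homotopyEquivalences_le_quasiIso C (up ℤ) _ hf))
    (isInvertedBy_totPlus_Q R)
    (fun K => (quasiIso_quotient_map_iff _).2 (hj K)) (isIso_derivedCoaugmentation_app η hη I hI)

include j in
/-- The total right derived functor of `F` is induced by an exact complex valued functor
coaugmented by `F`, if there are functorial resolutions by complexes of acyclic objects. -/
lemma isInducedBy_of_isAcyclicFor [PreservesFiniteLimits R] [PreservesFiniteColimits R]
    (hj : ∀ K, QuasiIso (j.app K).hom) (hI : ∀ K n, IsAcyclicFor η ((I.obj K).obj.X n))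
    (RF : DerivedCategory.Plus C ⥤ DerivedCategory.Plus D)
    (α : toDerivedPlus F ⟶ DerivedCategory.Plus.Qh ⋙ RF) (h : IsTotalRightDerivedPlus F RF α) :
    IsInducedBy RF α R η hη := by
  obtain ⟨e, he⟩ := exists_iso_of_isTotalRightDerived (q := HomotopyCategory.Plus.quotient C)
    (derivedCoaugmentation η hη) I j h
    HomotopyCategory.Plus.quotient_obj_surjective (isInvertedBy_totPlus_Q R)
    (fun K => (quasiIso_quotient_map_iff _).2 (hj K)) (isIso_derivedCoaugmentation_app η hη I hI)
  refine ⟨e, ?_⟩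
  rw [derivedCoaugmentation, Category.assoc, Iso.inv_comp_eq] at he
  exact he

end DerivedComplexValued

/-! ### Exactness of products of pro-objects -/

section ExactProducts

/-- Powers of epimorphisms are epimorphisms. -/
class HasExactPowers (P : Type u) [Category.{v} P] [HasProducts.{v} P] : Prop where
  epi_powMap (J : Type v) {X Y : P} (f : X ⟶ Y) [Epi f] : Epi (Limits.Pi.map fun _ : J => f)

lemma mono_sigmaMap {D : Type u} [Category.{v} D] [HasFiniteLimits D] [HasCoproducts.{v} D]
    [AB4OfSize.{v} D] {J : Type v} {X Y : J → D} (f : ∀ i, X i ⟶ Y i) (hf : ∀ i, Mono (f i)) :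
    Mono (Limits.Sigma.map f) := by
  let τ : Discrete.functor X ⟶ Discrete.functor Y := Discrete.natTrans fun i => f i.as
  have (i : Discrete J) : Mono (τ.app i) := hf i.as
  have : Mono τ := NatTrans.mono_of_mono_app τ
  exact inferInstanceAs (Mono (colim.map τ))

lemma epi_piMap_op {D : Type u} [Category.{v} D] [HasFiniteLimits D] [HasCoproducts.{v} D]
    [AB4OfSize.{v} D] {J : Type v} {X Y : J → D} (f : ∀ i, Y i ⟶ X i) (hf : ∀ i, Mono (f i)) :
    Epi (Limits.Pi.map fun i => (f i).op) := by
  have h : Limits.Pi.map (fun i => (f i).op) = (opCoproductIsoProduct X).inv ≫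
      (Limits.Sigma.map f).op ≫ (opCoproductIsoProduct Y).hom := by
    rw [Iso.eq_inv_comp]
    refine Limits.Pi.hom_ext _ _ fun i => ?_
    rw [Category.assoc, Category.assoc, opCoproductIsoProduct_hom_comp_π, Pi.map_π, ← op_comp,
      Sigma.ι_map, ← Category.assoc, opCoproductIsoProduct_hom_comp_π, ← op_comp]
  have := mono_sigmaMap f hf
  rw [h]
  infer_instance

/-- Filtered colimits of ind-objects are exact, and a coproduct is a filtered colimit of finite
coproducts. -/
lemma ab4OfSize_ind (A : Type u) [Category.{v} A] [Abelian A] : AB4OfSize.{v} (Ind A) := by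
  let _ : Abelian (Ind A) := indAbelian
  have : HasFiniteBiproducts (Ind A) := HasFiniteBiproducts.of_hasFiniteProducts
  exact AB4.of_AB5 (Ind A)

/-- Dually, a power of an epimorphism in `Pro(A)` is a coproduct of monomorphisms in `Ind(Aᵒᵖ)`. -/
instance (A : Type u) [Category.{v} A] [Abelian A] : HasExactPowers (Pro A) where
  epi_powMap J X Y f hf := by
    let _ : AB4OfSize.{v} (Ind Aᵒᵖ) := ab4OfSize_ind _
    let f' : @Quiver.Hom (Ind Aᵒᵖ)ᵒᵖ _ X Y := f
    have hf' : @Epi (Ind Aᵒᵖ)ᵒᵖ _ X Y f' := hf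
    exact epi_piMap_op (fun _ : J => f'.unop)
      (fun _ => @unop_mono_of_epi (Ind Aᵒᵖ) _ _ _ f' hf')

end ExactProducts

/-! ### Exactness and acyclicity of the resolutions given by resolution functors -/

section Resolutions

open ComplexShape

variable {C D : Type*} [Category* C] [Abelian C]
  (R : C ⥤ C) (ι : 𝟭 C ⟶ R)

lemma cokerπ_app_epi (X : C) : Epi ((cokerπ R ι).app X) :=
  inferInstanceAs (Epi (cokernel.π (ι.app X)))

lemma exists_of_comp_cokerπ_eq_zero {X A : C} [Mono (ι.app X)] (x : A ⟶ R.obj X)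
    (hx : x ≫ (cokerπ R ι).app X = 0) : ∃ y : A ⟶ X, y ≫ ι.app X = x := by
  have h : (ShortComplex.mk (ι.app X) ((cokerπ R ι).app X) (ι_cokerπ R ι X)).Exact :=
    ShortComplex.exact_cokernel (ι.app X)
  have : Mono (ShortComplex.mk (ι.app X) ((cokerπ R ι).app X) (ι_cokerπ R ι X)).f :=
    inferInstanceAs (Mono (ι.app X))
  exact ⟨h.lift x hx, h.lift_f x hx⟩

instance [R.Additive] : (cokerFunctor R ι).Additive where
  map_add {X Y f g} := by
    have := cokerπ_app_epi R ι X
    rw [← cancel_epi ((cokerπ R ι).app X), ← (cokerπ R ι).naturality, R.map_add,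
      Preadditive.add_comp, Preadditive.comp_add, (cokerπ R ι).naturality, (cokerπ R ι).naturality]

/-- The `3 × 3` lemma. -/
lemma shortExact_of_columns {S T U : ShortComplex C} (ι : S ⟶ T) (p : T ⟶ U)
    (hS : S.ShortExact) (hT : T.ShortExact) [Mono ι.τ₁] [Mono ι.τ₂] [Mono ι.τ₃]
    [Epi p.τ₁] [Epi p.τ₂] [Epi p.τ₃] (w₁ : ι.τ₁ ≫ p.τ₁ = 0) (w₂ : ι.τ₂ ≫ p.τ₂ = 0)
    (h₂ : ∀ {A : C} (x : A ⟶ T.X₂), x ≫ p.τ₂ = 0 → ∃ y : A ⟶ S.X₂, y ≫ ι.τ₂ = x)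
    (h₃ : ∀ {A : C} (x : A ⟶ T.X₃), x ≫ p.τ₃ = 0 → ∃ y : A ⟶ S.X₃, y ≫ ι.τ₃ = x) :
    U.ShortExact := by
  have := hS.mono_f
  have := hS.epi_g
  have := hT.mono_f
  have := hT.epi_g
  refine
    { exact := ?_
      mono_f := ?_
      epi_g := ?_ }
  · rw [ShortComplex.exact_iff_exact_up_to_refinements]
    intro A x hx
    obtain ⟨A₁, π₁, _, y, hy⟩ := surjective_up_to_refinements_of_epi p.τ₂ x
    obtain ⟨z, hz⟩ := h₃ (y ≫ T.g) (by
      rw [Category.assoc, ← p.comm₂₃, ← Category.assoc, ← hy, Category.assoc, hx, comp_zero])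
    obtain ⟨A₂, π₂, _, w, hw⟩ := surjective_up_to_refinements_of_epi S.g z
    obtain ⟨A₃, π₃, _, t, ht⟩ := hT.exact.exact_up_to_refinements
      (π₂ ≫ y - w ≫ ι.τ₂) (by
        rw [Preadditive.sub_comp, Category.assoc, Category.assoc, ι.comm₂₃, ← hz,
          ← Category.assoc w, ← hw, Category.assoc, sub_self])
    refine ⟨A₃, π₃ ≫ π₂ ≫ π₁, inferInstance, t ≫ p.τ₁, ?_⟩
    rw [Category.assoc t, p.comm₁₂, ← Category.assoc t, ← ht]
    simp only [Category.assoc, Preadditive.comp_sub, Preadditive.sub_comp, w₂, comp_zero,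
      sub_zero, hy]
  · refine Preadditive.mono_of_cancel_zero _ fun {A} x hx => ?_
    obtain ⟨A₁, π₁, _, y, hy⟩ := surjective_up_to_refinements_of_epi p.τ₁ x
    obtain ⟨z, hz⟩ := h₂ (y ≫ T.f) (by
      rw [Category.assoc, ← p.comm₁₂, ← Category.assoc, ← hy, Category.assoc, hx, comp_zero])
    have hz' : z ≫ S.g = 0 := by
      rw [← cancel_mono ι.τ₃, Category.assoc, ← ι.comm₂₃, ← Category.assoc, hz, Category.assoc,
        T.zero, comp_zero, zero_comp]
    have hw : hS.exact.lift z hz' ≫ ι.τ₁ = y := by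
      rw [← cancel_mono T.f, Category.assoc, ι.comm₁₂, ← Category.assoc, hS.exact.lift_f, hz]
    rw [← cancel_epi π₁, hy, ← hw, Category.assoc, w₁, comp_zero, comp_zero]
  · have : Epi (p.τ₂ ≫ U.g) := by
      rw [p.comm₂₃]
      infer_instance
    exact epi_of_epi p.τ₂ _

/-- In the `3 × 3` diagram with rows `S`, `R(S)` and the cokernels, the first two rows are exact and
so are the columns. -/
lemma shortExact_map_cokerFunctor [R.Additive] [PreservesFiniteLimits R]
    [PreservesFiniteColimits R] [∀ X, Mono (ι.app X)] (S : ShortComplex C) (hS : S.ShortExact) :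
    (S.map (cokerFunctor R ι)).ShortExact := by
  let i : S ⟶ S.map R :=
    { τ₁ := ι.app S.X₁
      τ₂ := ι.app S.X₂
      τ₃ := ι.app S.X₃
      comm₁₂ := (ι.naturality S.f).symm
      comm₂₃ := (ι.naturality S.g).symm }
  have h₁ : Mono i.τ₁ := inferInstanceAs (Mono (ι.app S.X₁))
  have h₂ : Mono i.τ₂ := inferInstanceAs (Mono (ι.app S.X₂))
  have h₃ : Mono i.τ₃ := inferInstanceAs (Mono (ι.app S.X₃))
  let p : S.map R ⟶ S.map (cokerFunctor R ι) := S.mapNatTrans (cokerπ R ι)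
  have h₁' : Epi p.τ₁ := cokerπ_app_epi R ι S.X₁
  have h₂' : Epi p.τ₂ := cokerπ_app_epi R ι S.X₂
  have h₃' : Epi p.τ₃ := cokerπ_app_epi R ι S.X₃
  exact shortExact_of_columns i p hS (hS.map_of_exact R) (ι_cokerπ R ι _) (ι_cokerπ R ι _)
    (exists_of_comp_cokerπ_eq_zero R ι) (exists_of_comp_cokerπ_eq_zero R ι)

section

variable [R.Additive]

/-- The functors `K^i` defined by a resolution functor are exact. -/
lemma preservesFiniteLimits_and_colimits_resolutionK [PreservesFiniteLimits R]
    [PreservesFiniteColimits R]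
    [∀ X, Mono (ι.app X)] (i : ℕ) : PreservesFiniteLimits (resolutionK R ι i) ∧
      PreservesFiniteColimits (resolutionK R ι i) := by
  induction i with
  | zero => exact ⟨inferInstanceAs (PreservesFiniteLimits (𝟭 C)),
      inferInstanceAs (PreservesFiniteColimits (𝟭 C))⟩
  | succ i hi =>
    obtain ⟨_, _⟩ := hi
    obtain ⟨_, _⟩ := ((cokerFunctor R ι).exact_tfae.out 0 3).1 (shortExact_map_cokerFunctor R ι)
    exact ⟨inferInstanceAs (PreservesFiniteLimits (resolutionK R ι i ⋙ cokerFunctor R ι)),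
      inferInstanceAs (PreservesFiniteColimits (resolutionK R ι i ⋙ cokerFunctor R ι))⟩

end

lemma resolution_d (X : C) (q : ℕ) : ((resolution R ι).obj X).d q (q + 1) =
    ((cokerπ R ι).app ((resolutionK R ι q).obj X) ≫ ι.app ((resolutionK R ι (q + 1)).obj X) :
      R.obj ((resolutionK R ι q).obj X) ⟶ R.obj ((resolutionK R ι (q + 1)).obj X)) :=
  CochainComplex.of_d (fun i => (resolutionK R ι i ⋙ R).obj X)
      (fun i => (resolutionD R ι i).app X) q

/-- Short exact sequences `0 ⟶ K^q ⟶ Y^q ⟶ K^(q+1) ⟶ 0` can be spliced. -/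
lemma IsCoresolution.of_splice (Y : CochainComplex C ℕ) (K : ℕ → C) (i : ∀ q, K q ⟶ Y.X q)
    (p : ∀ q, Y.X q ⟶ K (q + 1)) (hd : ∀ q, Y.d q (q + 1) = p q ≫ i (q + 1))
    (hi : ∀ q, Mono (i q)) (hp : ∀ q, Epi (p q))
    (hip : ∀ q {A : C} (x : A ⟶ Y.X q), x ≫ p q = 0 → ∃ y : A ⟶ K q, y ≫ i q = x) :
    IsCoresolution Y (i 0) where
  mono := hi 0
  exact_zero {A} x hx := by
    rw [hd, ← Category.assoc, ← zero_comp (f := i 1), cancel_mono] at hx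
    obtain ⟨y, hy⟩ := hip 0 x hx
    exact ⟨A, 𝟙 A, inferInstance, y, (Category.id_comp _).trans hy.symm⟩
  exact_succ q {A} x hx := by
    rw [hd, ← Category.assoc, ← zero_comp (f := i (q + 1 + 1)), cancel_mono] at hx
    obtain ⟨y, hy⟩ := hip (q + 1) x hx
    obtain ⟨A', π, hπ, z, hz⟩ := surjective_up_to_refinements_of_epi (p q) y
    refine ⟨A', π, hπ, z, ?_⟩
    rw [hd, ← Category.assoc, ← hz, Category.assoc, hy]

/-- A resolution functor defines resolutions. -/
lemma isAcyclicFor_resolutionCoaugmentation [∀ X, Mono (ι.app X)] (X : C) :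
    IsAcyclicFor (resolutionCoaugmentation R ι) X :=
  IsCoresolution.of_splice ((resolution R ι).obj X) (fun q => (resolutionK R ι q).obj X)
    (fun q => ι.app ((resolutionK R ι q).obj X))
    (fun q => (cokerπ R ι).app ((resolutionK R ι q).obj X)) (resolution_d R ι X)
    (fun _ => ‹∀ X, Mono (ι.app X)› _) (fun _ => cokerπ_app_epi R ι _)
    (fun _ => exists_of_comp_cokerπ_eq_zero R ι)

/-- The monomorphism `X ⟶ R(X)` has a retraction. -/
def IsSplit (X : C) : Prop := ∃ r : R.obj X ⟶ X, ι.app X ≫ r = 𝟙 X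

variable {R ι}

omit [Abelian C] in
lemma IsSplit.of_retract {X Y : C} (i : X ⟶ Y) (p : Y ⟶ X) (h : i ≫ p = 𝟙 X)
    (hY : IsSplit R ι Y) : IsSplit R ι X := by
  obtain ⟨r, hr⟩ := hY
  refine ⟨R.map i ≫ r ≫ p, ?_⟩
  have nat : i ≫ ι.app Y = ι.app X ≫ R.map i := ι.naturality i
  rw [← Category.assoc, ← nat, Category.assoc, reassoc_of% hr, h]

/-- The splitting is recorded by identities between morphisms because these survive every additive
functor, whether or not it is exact. -/
lemma IsSplit.exists_splitting {X : C} (hX : IsSplit R ι X) :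
    ∃ (r : R.obj X ⟶ X) (s : (cokerFunctor R ι).obj X ⟶ R.obj X), ι.app X ≫ r = 𝟙 X ∧
      s ≫ (cokerπ R ι).app X = 𝟙 _ ∧ r ≫ ι.app X + (cokerπ R ι).app X ≫ s = 𝟙 (R.obj X) := by
  obtain ⟨r, hr⟩ := hX
  have h0 : ι.app X ≫ (𝟙 (R.obj X) - r ≫ ι.app X) = 0 := by
    rw [Preadditive.comp_sub, Category.comp_id, ← Category.assoc, hr]
    exact (congrArg (_ - ·) (Category.id_comp _)).trans (sub_self _)
  obtain ⟨s, hs⟩ : ∃ s : (cokerFunctor R ι).obj X ⟶ R.obj X,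
      (cokerπ R ι).app X ≫ s = 𝟙 (R.obj X) - r ≫ ι.app X :=
    ⟨cokernel.desc (ι.app X) _ h0, cokernel.π_desc _ _ _⟩
  have := cokerπ_app_epi R ι X
  refine ⟨r, s, hr, ?_, ?_⟩
  · rw [← cancel_epi ((cokerπ R ι).app X), ← Category.assoc, hs, Preadditive.sub_comp,
      Category.id_comp, Category.assoc, ι_cokerπ, comp_zero, sub_zero, Category.comp_id]
  · rw [hs, add_sub_cancel]

omit [Abelian C] in
lemma exists_of_comp_map_eq_zero [Preadditive C] {D : Type*} [Category* D] [Preadditive D]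
    (F : C ⥤ D) [F.Additive] {X Y Z : C} (i : X ⟶ Y) (p : Y ⟶ Z) (r : Y ⟶ X) (s : Z ⟶ Y)
    (h : r ≫ i + p ≫ s = 𝟙 Y) {A : D} (x : A ⟶ F.obj Y) (hx : x ≫ F.map p = 0) :
    ∃ y : A ⟶ F.obj X, y ≫ F.map i = x := by
  refine ⟨x ≫ F.map r, ?_⟩
  have h' : F.map r ≫ F.map i = 𝟙 _ - F.map p ≫ F.map s := by
    rw [eq_sub_iff_add_eq, ← F.map_comp, ← F.map_comp, ← F.map_add, h, F.map_id]
  rw [Category.assoc, h', Preadditive.comp_sub, reassoc_of% hx, zero_comp, sub_zero,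
    Category.comp_id]

section

variable (hR : ∀ Y, IsSplit R ι (R.obj Y))
include hR

/-- If `X` is split, its cokernel is a direct summand of `R(X)`, which is itself split. So splitness
propagates along all the `K^i`. -/
lemma IsSplit.cokerFunctor_obj {X : C} (hX : IsSplit R ι X) :
    IsSplit R ι ((cokerFunctor R ι).obj X) := by
  obtain ⟨r, s, -, h, -⟩ := hX.exists_splitting
  exact .of_retract s _ h (hR X)

lemma IsSplit.resolutionK_obj {X : C} (hX : IsSplit R ι X) (q : ℕ) :
    IsSplit R ι ((resolutionK R ι q).obj X) := by
  induction q with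
  | zero => exact hX
  | succ q hq => exact hq.cokerFunctor_obj hR

/-- Additive functors preserve the resolutions of the objects `X` such that `X ⟶ R(X)` splits. -/
lemma IsSplit.isCoresolution {D : Type*} [Category* D] [Abelian D] (F : C ⥤ D) [F.Additive]
    {X : C} (hX : IsSplit R ι X) :
    IsCoresolution ((F.mapHomologicalComplex (up ℕ)).obj ((resolution R ι).obj X))
      (F.map ((resolutionCoaugmentation R ι).app X)) := by
  have h (q : ℕ) := (hX.resolutionK_obj hR q).exists_splitting
  refine IsCoresolution.of_splice
    ((F.mapHomologicalComplex (up ℕ)).obj ((resolution R ι).obj X))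
    (fun q => F.obj ((resolutionK R ι q).obj X))
    (fun q => F.map (ι.app ((resolutionK R ι q).obj X)))
    (fun q => F.map ((cokerπ R ι).app ((resolutionK R ι q).obj X))) (fun q => ?_)
    (fun q => ?_) (fun q => ?_) (fun q A x hx => ?_)
  · exact (congrArg F.map (resolution_d R ι X q)).trans (F.map_comp _ _)
  · obtain ⟨r, s, h, -, -⟩ := h q
    exact mono_of_mono_fac (h := 𝟙 (F.obj ((resolutionK R ι q).obj X)))
      ((F.map_comp _ _).symm.trans ((congrArg F.map h).trans (F.map_id _)))
  · obtain ⟨r, s, -, h, -⟩ := h q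
    exact epi_of_epi_fac (h := 𝟙 (F.obj ((resolutionK R ι (q + 1)).obj X)))
      ((F.map_comp _ _).symm.trans ((congrArg F.map h).trans (F.map_id _)))
  · obtain ⟨r, s, -, -, h⟩ := h q
    exact exists_of_comp_map_eq_zero F _ _ r s h x hx

end

section

variable [R.Additive] (hR : ∀ Y, IsSplit R ι (R.obj Y))
include hR

/-- The terms of the simple complexes defined by the resolution are split. -/
lemma isSplit_totPlus (K : CochainComplex.Plus C) (n : ℤ) :
    IsSplit R ι (((totPlus (resolution R ι)).obj K).obj.X n) := by
  let M := doubleComplex (resolution R ι) K.obj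
  have hM (p : ℤ) (q : ℕ) : IsSplit R ι ((M.X p).X q) :=
    hR ((resolutionK R ι q).obj (K.obj.X p))
  choose r hr using hM
  obtain ⟨m, hm⟩ := exists_isBoundedBelow_doubleComplex (resolution R ι) K
  have key := tot_id hm n ((n - m).toNat + 1) (by lia)
  -- The retraction is the sum of those of the finitely many summands; by naturality of `ι` the
  -- claim reduces to `tot_id`. No compatibility with differentials is needed, since splitness is a
  -- condition on each term separately.
  refine ⟨∑ q ∈ Finset.range ((n - m).toNat + 1), R.map (totπ M (n - q) q n) ≫ r (n - q) q ≫
    totι M (n - q) q n (by lia), ?_⟩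
  have nat {X Y : C} (f : X ⟶ Y) : ι.app X ≫ R.map f = f ≫ ι.app Y := (ι.naturality f).symm
  refine Eq.trans ?_ key.symm
  refine (Preadditive.comp_sum _ _ _).trans (Finset.sum_congr rfl fun q _ => ?_)
  refine (Category.assoc _ _ _).symm.trans ?_
  refine (congrArg (· ≫ _) (nat (totπ M (n - q) q n))).trans ?_
  refine (Category.assoc _ _ _).trans ?_
  refine congrArg (_ ≫ ·) ?_
  refine (Category.assoc _ _ _).symm.trans ?_
  exact (congrArg (· ≫ _) (hr (n - q) q)).trans (Category.id_comp _)

end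

variable (R ι) in
/-- The functorial resolution `K ⟶ R^*(K)` of bounded below complexes. -/
def toTotPlusResolution [R.PreservesZeroMorphisms] :
    𝟭 (CochainComplex.Plus C) ⟶ totPlus (resolution R ι) where
  app K := ObjectProperty.homMk
    ((totCoaugmentation (𝟭 C) (resolutionCoaugmentation R ι)
      (resolutionCoaugmentation_d R ι)).app K).hom
  naturality _ _ f := (totCoaugmentation (𝟭 C) (resolutionCoaugmentation R ι)
    (resolutionCoaugmentation_d R ι)).naturality f

lemma quasiIso_toTotPlusResolution [R.Additive] [∀ X, Mono (ι.app X)]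
    (K : CochainComplex.Plus C) : QuasiIso ((toTotPlusResolution R ι).app K).hom :=
  quasiIso_totCoaugmentation (resolutionCoaugmentation R ι) (resolutionCoaugmentation_d R ι) K
    fun _ => isAcyclicFor_resolutionCoaugmentation R ι _

end Resolutions

/-! ### The resolution functor `C_H` -/

section ResolutionFunctorCH

variable {P : Type u} [Category.{v} P] [Abelian P] [HasProducts.{v} P]

variable (P) in
/-- The functor `X ↦ ∏_{j ∈ J} X`. -/
def powFunctor (J : Type v) : P ⥤ P where
  obj X := ∏ᶜ fun _ : J => X
  map f := Limits.Pi.map fun _ : J => f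
  map_id X := Limits.Pi.hom_ext _ _ fun h => by simp
  map_comp f g := Limits.Pi.hom_ext _ _ fun h => by simp

variable (P) in
/-- The functor `X ↦ ∏_{j ∈ J} X` is the limit of constant diagrams. -/
def powFunctorIso (J : Type v) : powFunctor P J ≅ Functor.const (Discrete J) ⋙ lim :=
  NatIso.ofComponents (fun X => HasLimit.isoOfNatIso (Discrete.natIso fun _ => Iso.refl X))
    (fun f => by
      refine limit.hom_ext fun j => ?_
      simp [powFunctor, Limits.Pi.map])

instance (J : Type v) : PreservesFiniteLimits (powFunctor P J) :=
  preservesFiniteLimits_of_natIso (powFunctorIso P J).symm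

instance (J : Type v) : (powFunctor P J).Additive :=
  Functor.additive_of_preserves_binary_products _

instance [HasExactPowers P] (J : Type v) : PreservesFiniteColimits (powFunctor P J) := by
  have : (powFunctor P J).PreservesEpimorphisms := ⟨fun f _ => HasExactPowers.epi_powMap J f⟩
  have := (powFunctor P J).preservesHomology_of_preservesEpis_and_kernels
  exact Functor.preservesFiniteColimits_of_preservesHomology _

variable {H : Type v} [Group H]

/-- Limits and colimits of objects with action are computed on underlying objects, where `C_H` is
the power functor. -/
instance : PreservesFiniteLimits (CH P H) where
  preservesFiniteLimits J _ _ := Action.preservesLimitsOfShape_of_preserves _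
    (inferInstanceAs (PreservesLimitsOfShape J (Action.forget P H ⋙ powFunctor P H)))

instance [HasExactPowers P] : PreservesFiniteColimits (CH P H) where
  preservesFiniteColimits J _ _ := Action.preservesColimitsOfShape_of_preserves _
    (inferInstanceAs (PreservesColimitsOfShape J (Action.forget P H ⋙ powFunctor P H)))

/-- The projections of `C_H(A)`. -/
def CHπ (A : Action P H) (h : H) : ((CH P H).obj A).V ⟶ A.V := Pi.π (fun _ : H => A.V) h

lemma CH_hom_ext {A : Action P H} {X : P} {f g : X ⟶ ((CH P H).obj A).V}
    (w : ∀ h, f ≫ CHπ A h = g ≫ CHπ A h) : f = g :=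
  Limits.Pi.hom_ext _ _ w

/-- The morphism to `C_H(A)` with given components. -/
def CHlift {A : Action P H} {X : P} (f : H → (X ⟶ A.V)) : X ⟶ ((CH P H).obj A).V := Pi.lift f

lemma CHlift_π {A : Action P H} {X : P} (f : H → (X ⟶ A.V)) (h : H) :
    CHlift f ≫ CHπ A h = f h :=
  limit.lift_π _ _

lemma CH_act_π (A : Action P H) (γ h : H) :
    act ((CH P H).obj A) γ ≫ CHπ A h = CHπ A (γ⁻¹ * h) ≫ act A γ :=
  limit.lift_π _ _

lemma CH_map_π {A B : Action P H} (f : A ⟶ B) (h : H) :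
    ((CH P H).map f).hom ≫ CHπ B h = CHπ A h ≫ f.hom :=
  Pi.map_π (fun _ : H => f.hom) h

lemma CHι_π (A : Action P H) (h : H) : ((CHι P H).app A).hom ≫ CHπ A h = 𝟙 A.V :=
  limit.lift_π _ _

instance (A : Action P H) : Mono ((CHι P H).app A) := by
  have : Mono ((CHι P H).app A).hom := by
    have : Mono (𝟙 A.V) := inferInstance
    exact mono_of_mono_fac (h := 𝟙 A.V) (CHι_π A 1)
  exact (Action.forget P H).mono_of_mono_map this

/-- `C_H`, with `ι`, is a resolution functor. -/
lemma isResolutionFunctor_CH [HasExactPowers P] : IsResolutionFunctor (CH P H) (CHι P H) :=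
  ⟨inferInstance, inferInstance, inferInstance, inferInstance⟩

/-- The monomorphism `C_H(A) ⟶ C_H(C_H(A))` has a retraction. -/
lemma isSplit_CH_obj (A : Action P H) : IsSplit (CH P H) (CHι P H) ((CH P H).obj A) := by
  -- In terms of elements, a family `f(h)(k)` is sent to its diagonal `h ↦ f(h)(h)`. This is
  -- equivariant because `γ` translates both indices, and it recovers `a` from `f(h)(k) = a(k)`.
  let r : ((CH P H).obj ((CH P H).obj A)).V ⟶ ((CH P H).obj A).V :=
    CHlift fun h => CHπ ((CH P H).obj A) h ≫ CHπ A h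
  have hr (h : H) : r ≫ CHπ A h = CHπ ((CH P H).obj A) h ≫ CHπ A h := CHlift_π _ h
  refine ⟨⟨r, fun γ => ?_⟩, Action.hom_ext _ _ (CH_hom_ext fun h => ?_)⟩
  · change act ((CH P H).obj ((CH P H).obj A)) γ ≫ r = r ≫ act ((CH P H).obj A) γ
    refine CH_hom_ext fun h => ?_
    rw [Category.assoc, hr, ← Category.assoc, CH_act_π, Category.assoc, CH_act_π, Category.assoc,
      CH_act_π, ← Category.assoc r, hr, Category.assoc]
  · change (((CHι P H).app ((CH P H).obj A)).hom ≫ r) ≫ CHπ A h = 𝟙 ((CH P H).obj A).V ≫ CHπ A h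
    have h2 : ((CHι P H).app ((CH P H).obj A)).hom ≫ CHπ ((CH P H).obj A) h =
      𝟙 ((CH P H).obj A).V := CHι_π _ h
    rw [Category.assoc, hr]
    exact (Category.assoc _ _ _).symm.trans (congrArg (· ≫ CHπ A h) h2)

/-- Fixed points of `C_H(A)` are given by their component at `1`. -/
lemma comp_act_CH_iff {A : Action P H} {X : P} (f : X ⟶ ((CH P H).obj A).V) :
    (∀ γ, f ≫ act ((CH P H).obj A) γ = f) ↔
      ∀ γ, f ≫ CHπ A γ = f ≫ CHπ A 1 ≫ act A γ := by
  constructor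
  · intro h γ
    rw [← congrArg (· ≫ CHπ A γ) (h γ), Category.assoc, CH_act_π, inv_mul_cancel]
  · intro h γ
    refine CH_hom_ext fun δ => ?_
    rw [Category.assoc, CH_act_π, ← Category.assoc, h, h, Category.assoc, Category.assoc,
      ← act_mul, mul_inv_cancel_left]

/-- The morphism to `A^H` given by a morphism on whose image `H` acts trivially. -/
def fixedPointsLift {A : Action P H} {X : P} (f : X ⟶ A.V) (hf : ∀ γ, f ≫ act A γ = f) :
    X ⟶ (fixedPoints P H).obj A :=
  ((fixedPoints_factors_iff A f).2 hf).choose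

lemma fixedPointsLift_ι {A : Action P H} {X : P} (f : X ⟶ A.V) (hf : ∀ γ, f ≫ act A γ = f) :
    fixedPointsLift f hf ≫ fixedPointsι A = f :=
  ((fixedPoints_factors_iff A f).2 hf).choose_spec

lemma fixedPointsι_act (A : Action P H) (γ : H) :
    fixedPointsι A ≫ act A γ = fixedPointsι A :=
  (fixedPoints_factors_iff A _).1 ⟨𝟙 _, Category.id_comp _⟩ γ

/-- The isomorphism `C_H(A)^H ≅ A`. -/
def fixedPointsCHObjIso (A : Action P H) : (fixedPoints P H).obj ((CH P H).obj A) ≅ A.V where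
  hom := fixedPointsι ((CH P H).obj A) ≫ CHπ A 1
  inv := fixedPointsLift (CHlift fun h => act A h) ((comp_act_CH_iff _).2 fun γ => by
    rw [← Category.assoc, CHlift_π, CHlift_π, act_one, Category.id_comp])
  hom_inv_id := by
    refine (cancel_mono (fixedPointsι ((CH P H).obj A))).1 (CH_hom_ext fun γ => ?_)
    rw [Category.assoc (_ ≫ _) (fixedPointsLift _ _), fixedPointsLift_ι, Category.assoc, CHlift_π,
      Category.id_comp, (comp_act_CH_iff _).1 (fixedPointsι_act ((CH P H).obj A)) γ,
      Category.assoc]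
  inv_hom_id := by
    rw [← Category.assoc, fixedPointsLift_ι, CHlift_π, act_one]

/-- The isomorphism `C_H(A)^H ≅ A`, natural in `A`. -/
def fixedPointsCHIso : CH P H ⋙ fixedPoints P H ≅ Action.forget P H :=
  NatIso.ofComponents fixedPointsCHObjIso (fun {A B} f => by
    change (fixedPoints P H).map ((CH P H).map f) ≫ fixedPointsι ((CH P H).obj B) ≫ CHπ B 1 =
      (fixedPointsι ((CH P H).obj A) ≫ CHπ A 1) ≫ f.hom
    rw [← Category.assoc, fixedPoints_map_ι, Category.assoc, CH_map_π, Category.assoc])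

instance : PreservesFiniteLimits (CH P H ⋙ fixedPoints P H) :=
  preservesFiniteLimits_of_natIso fixedPointsCHIso.symm

instance : PreservesFiniteColimits (CH P H ⋙ fixedPoints P H) :=
  preservesFiniteColimits_of_natIso fixedPointsCHIso.symm

variable [HasExactPowers P]

/-- In degree `i` this is the exact functor `K^i` followed by `C_H(·)^H`, which is isomorphic to the
exact forgetful functor. -/
instance : PreservesFiniteLimits (fixedPointsComplex (resolution (CH P H) (CHι P H))) where
  preservesFiniteLimits J _ _ := HomologicalComplex.preservesLimitsOfShape_of_eval _ fun i => by
    have := (preservesFiniteLimits_and_colimits_resolutionK (CH P H) (CHι P H) i).1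
    exact inferInstanceAs (PreservesLimitsOfShape J
      (resolutionK (CH P H) (CHι P H) i ⋙ CH P H ⋙ fixedPoints P H))

instance : PreservesFiniteColimits (fixedPointsComplex (resolution (CH P H) (CHι P H))) where
  preservesFiniteColimits J _ _ :=
    HomologicalComplex.preservesColimitsOfShape_of_eval _ fun i => by
      have := (preservesFiniteLimits_and_colimits_resolutionK (CH P H) (CHι P H) i).2
      exact inferInstanceAs (PreservesColimitsOfShape J
        (resolutionK (CH P H) (CHι P H) i ⋙ CH P H ⋙ fixedPoints P H))

omit [HasExactPowers P] in
lemma isAcyclicFor_fixedPoints_resolution {A : Action P H} (hA : IsSplit (CH P H) (CHι P H) A) :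
    IsAcyclicFor (fixedPointsCoaugmentation (resolutionCoaugmentation (CH P H) (CHι P H))) A :=
  hA.isCoresolution isSplit_CH_obj (fixedPoints P H)

end ResolutionFunctorCH

/-! ### Fixed points of `Hom(M, A)` -/

section FixedPointsHom

variable {P : Type u} [Category.{v} P] [Abelian P] [HasProducts.{v} P] {H : Type v} [Group H]

/-- The object `Hom(M, A)^H`. -/
abbrev homFixed (M : ModuleCat.{v} (MonoidAlgebra ℤ H)) (A : Action P H) : P :=
  (fixedPoints P H).obj (homAction M A)

variable {M N : ModuleCat.{v} (MonoidAlgebra ℤ H)} {A B : Action P H} {X : P}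

variable (M A) in
/-- The inclusion of `Hom(M, A)^H` in `Hom(M, A)`. -/
def homFixedι : homFixed M A ⟶ homObj M A.V := fixedPointsι (homAction M A)

instance : Mono (homFixedι M A) := inferInstanceAs (Mono (fixedPointsι (homAction M A)))

lemma homFixedι_act (γ : H) :
    homFixedι M A ≫ homMap (smulHom M γ⁻¹) (act A γ) = homFixedι M A :=
  fixedPointsι_act (homAction M A) γ

lemma homFixed_map_ι (φ : N ⟶ M) (f : A ⟶ B) :
    (fixedPoints P H).map (homActionMap φ f) ≫ homFixedι N B =
      homFixedι M A ≫ homMap φ.hom.toAddMonoidHom f.hom :=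
  fixedPoints_map_ι _

/-- Evaluation at `m` on `Hom(M, A)^H`. -/
def homFixedEval (m : M) : homFixed M A ⟶ A.V := homFixedι M A ≫ homEval m

lemma homFixed_ext {f g : X ⟶ homFixed M A}
    (h : ∀ m : M, f ≫ homFixedEval m = g ≫ homFixedEval m) : f = g := by
  refine (cancel_mono (homFixedι M A)).1 (homObj_ext fun m => ?_)
  rw [Category.assoc, Category.assoc]
  exact h m

lemma homFixedEval_add (m n : M) :
    homFixedEval (m + n) = (homFixedEval m + homFixedEval n : homFixed M A ⟶ A.V) := by
  rw [homFixedEval, homEval_add, Preadditive.comp_add, homFixedEval, homFixedEval]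

lemma homFixedEval_smul (γ : H) (m : M) :
    (homFixedEval (smulHom M γ m) : homFixed M A ⟶ A.V) = homFixedEval m ≫ act A γ := by
  rw [homFixedEval, ← homFixedι_act γ, Category.assoc, homMap_eval, ← smulHom_mul,
    inv_mul_cancel, smulHom_one, homFixedEval, Category.assoc]

/-- The morphism to `Hom(M, A)^H` given by an equivariant homomorphism. -/
def homFixedLift (f : M →+ (X ⟶ A.V)) (hf : ∀ γ m, f (smulHom M γ m) = f m ≫ act A γ) :
    X ⟶ homFixed M A :=
  fixedPointsLift (homLift f : X ⟶ homObj M A.V) fun γ => by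
    change homLift f ≫ homMap (smulHom M γ⁻¹) (act A γ) = homLift f
    refine homObj_ext fun m => ?_
    rw [Category.assoc, homMap_eval, ← Category.assoc, homLift_eval, homLift_eval, ← hf,
      ← smulHom_mul, mul_inv_cancel, smulHom_one]

lemma homFixedLift_eval (f : M →+ (X ⟶ A.V)) (hf : ∀ γ m, f (smulHom M γ m) = f m ≫ act A γ)
    (m : M) : homFixedLift f hf ≫ homFixedEval m = f m := by
  have h : homFixedLift f hf ≫ homFixedι M A = homLift f := fixedPointsLift_ι _ _
  rw [homFixedEval, ← Category.assoc, h, homLift_eval]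

lemma homFixedMap_eval (φ : N ⟶ M) (f : A ⟶ B) (n : N) :
    (fixedPoints P H).map (homActionMap φ f) ≫ homFixedEval n = homFixedEval (φ n) ≫ f.hom := by
  rw [homFixedEval, ← Category.assoc, homFixed_map_ι, Category.assoc, homMap_eval, homFixedEval,
    Category.assoc]
  rfl

/-- The homomorphism from `M` given by a morphism to `Hom(M, A)^H`. -/
def homFixedHom (x : X ⟶ homFixed M A) : M →+ (X ⟶ A.V) :=
  AddMonoidHom.mk' (fun m => x ≫ homFixedEval m) fun m n => by
    rw [homFixedEval_add, Preadditive.comp_add]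

/-! #### Free modules -/

/-- The `ℤH`-module structure on the group of morphisms `X ⟶ A`. -/
@[reducible]
def moduleHom (X : P) (A : Action P H) : Module (MonoidAlgebra ℤ H) (X ⟶ A.V) :=
  Module.compHom (X ⟶ A.V) (MonoidAlgebra.lift ℤ (AddMonoid.End (X ⟶ A.V)) H
    { toFun := fun γ => (Preadditive.rightComp X (act A γ) : (X ⟶ A.V) →+ (X ⟶ A.V))
      map_one' := by
        ext f
        change f ≫ act A 1 = f
        rw [act_one, Category.comp_id]
      map_mul' := fun γ δ => by
        ext f
        change f ≫ act A (γ * δ) = (f ≫ act A δ) ≫ act A γ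
        rw [act_mul, Category.assoc] }).toRingHom

attribute [local instance] moduleHom

lemma moduleHom_smul (γ : H) (f : X ⟶ A.V) : MonoidAlgebra.of ℤ H γ • f = f ≫ act A γ := by
  change MonoidAlgebra.lift ℤ (AddMonoid.End (X ⟶ A.V)) H _ (MonoidAlgebra.of ℤ H γ) f = _
  rw [MonoidAlgebra.lift_of]
  rfl

/-- Equivariant homomorphisms are linear. -/
lemma map_smul_of_equivariant (f : M →+ (X ⟶ A.V))
    (hf : ∀ γ m, f (smulHom M γ m) = f m ≫ act A γ) (r : MonoidAlgebra ℤ H) (m : M) :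
    f (r • m) = r • f m := by
  induction r using MonoidAlgebra.induction_on with
  | of γ => exact (hf γ m).trans (moduleHom_smul γ (f m)).symm
  | add r s hr hs => rw [add_smul, map_add, hr, hs, add_smul]
  | smul k r hr => rw [smul_assoc, map_zsmul, hr, smul_assoc]

variable {J : Type v} (b : Module.Basis J (MonoidAlgebra ℤ H) M)

/-- Morphisms `X ⟶ Hom(M, A)^H` are the same as `ℤH`-linear maps from `M` to the group of morphisms
`X ⟶ A`, so they are determined by their values on a basis, which can be prescribed freely. -/
lemma homFixed_ext_basis {f g : X ⟶ homFixed M A}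
    (h : ∀ j, f ≫ homFixedEval (b j) = g ≫ homFixedEval (b j)) : f = g := by
  let L (x : X ⟶ homFixed M A) : M →ₗ[MonoidAlgebra ℤ H] (X ⟶ A.V) :=
    { homFixedHom x with
      map_smul' := map_smul_of_equivariant (homFixedHom x) fun γ m => by
        change x ≫ homFixedEval _ = (x ≫ homFixedEval m) ≫ act A γ
        rw [homFixedEval_smul, Category.assoc] }
  exact homFixed_ext fun m => LinearMap.congr_fun (b.ext (f₁ := L f) (f₂ := L g) h) m

lemma exists_homFixedEval_basis (f : J → (X ⟶ A.V)) :
    ∃ g : X ⟶ homFixed M A, ∀ j, g ≫ homFixedEval (b j) = f j := by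
  refine ⟨homFixedLift (b.constr ℕ f).toAddMonoidHom fun γ m =>
    ((b.constr ℕ f).map_smul (MonoidAlgebra.of ℤ H γ) m).trans (moduleHom_smul _ _), fun j => ?_⟩
  exact (homFixedLift_eval _ _ _).trans (b.constr_basis ℕ f j)

/-- The isomorphism `Hom(M, A)^H ≅ ∏_{j ∈ J} A`, for a free `ℤH`-module with basis `J`. -/
def homFixedObjIso (A : Action P H) : homFixed M A ≅ ∏ᶜ fun _ : J => A.V where
  hom := Pi.lift fun j => homFixedEval (b j)
  inv := (exists_homFixedEval_basis b fun j => Pi.π (fun _ : J => A.V) j).choose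
  hom_inv_id := homFixed_ext_basis b fun j => by
    rw [Category.assoc, (exists_homFixedEval_basis b _).choose_spec, Pi.lift_π, Category.id_comp]
  inv_hom_id := Limits.Pi.hom_ext _ _ fun j => by
    rw [Category.assoc, Pi.lift_π, (exists_homFixedEval_basis b _).choose_spec, Category.id_comp]

variable (P M) in
/-- The functor `A ↦ Hom(M, A)^H`. -/
def homFixedFunctor : Action P H ⥤ P where
  obj A := homFixed M A
  map f := (fixedPoints P H).map (homActionMap (𝟙 M) f)
  map_id A := homFixed_ext fun m => by
    rw [homFixedMap_eval, Category.id_comp]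
    exact Category.comp_id _
  map_comp f g := homFixed_ext fun m => by
    rw [homFixedMap_eval, Category.assoc, homFixedMap_eval, ← Category.assoc, homFixedMap_eval,
      Category.assoc]
    rfl

variable (P) in
/-- The isomorphism `Hom(M, A)^H ≅ ∏_{j ∈ J} A`, natural in `A`. -/
def homFixedFunctorIso : homFixedFunctor P M ≅ Action.forget P H ⋙ powFunctor P J :=
  NatIso.ofComponents (homFixedObjIso b) (fun {A B} f => by
    change (fixedPoints P H).map (homActionMap (𝟙 M) f) ≫ (Pi.lift fun j => homFixedEval (b j)) =
      (Pi.lift fun j => homFixedEval (b j)) ≫ (Limits.Pi.map fun _ : J => f.hom)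
    refine Limits.Pi.hom_ext _ _ fun j => ?_
    rw [Category.assoc, Pi.lift_π, homFixedMap_eval, Category.assoc, Pi.map_π, ← Category.assoc,
      Pi.lift_π]
    rfl)

/-- In each degree the functor is a power of the forgetful functor, indexed by a basis of `F_n`. -/
instance (F : FreeResolution H) :
    PreservesFiniteLimits (fixedPointsComplex (homComplex P F.complex)) where
  preservesFiniteLimits J _ _ := HomologicalComplex.preservesLimitsOfShape_of_eval _ fun n => by
    have := F.free n
    have : PreservesFiniteLimits (homFixedFunctor P (F.complex.X n)) :=
      preservesFiniteLimits_of_natIso (homFixedFunctorIso P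
        (Module.Free.chooseBasis (MonoidAlgebra ℤ H) (F.complex.X n))).symm
    exact inferInstanceAs (PreservesLimitsOfShape J (homFixedFunctor P (F.complex.X n)))

instance [HasExactPowers P] (F : FreeResolution H) :
    PreservesFiniteColimits (fixedPointsComplex (homComplex P F.complex)) where
  preservesFiniteColimits J _ _ :=
    HomologicalComplex.preservesColimitsOfShape_of_eval _ fun n => by
      have := F.free n
      have : PreservesFiniteColimits (homFixedFunctor P (F.complex.X n)) :=
        preservesFiniteColimits_of_natIso (homFixedFunctorIso P
          (Module.Free.chooseBasis (MonoidAlgebra ℤ H) (F.complex.X n))).symm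
      exact inferInstanceAs (PreservesColimitsOfShape J (homFixedFunctor P (F.complex.X n)))

end FixedPointsHom

/-! ### Free resolutions and the objects `C_H(A)` -/

section FreeResolutions

namespace FreeResolution

variable {H : Type v} [Group H] (F : FreeResolution H)

lemma exists_eq_of_d_eq_zero (n : ℕ) (x : F.complex.X (n + 1)) (hx : F.complex.d (n + 1) n x = 0) :
    ∃ y : F.complex.X (n + 2), F.complex.d (n + 2) (n + 1) y = x := by
  have h := F.exactAt n
  rw [HomologicalComplex.exactAt_iff' _ (n + 2) (n + 1) n (by simp) (by simp),
    ShortComplex.moduleCat_exact_iff] at h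
  exact h x hx

lemma d_d (n : ℕ) (x : F.complex.X (n + 2)) :
    F.complex.d (n + 1) n (F.complex.d (n + 2) (n + 1) x) = 0 := by
  rw [← ConcreteCategory.comp_apply, F.complex.d_comp_d]
  rfl

/-- Homomorphisms from `F_n` lift along the differentials. -/
lemma exists_lift (n : ℕ) (e : F.complex.X n →+ F.complex.X n)
    (he : ∀ x, ∃ y : F.complex.X (n + 1), F.complex.d (n + 1) n y = e x) :
    ∃ s : F.complex.X n →+ F.complex.X (n + 1), ∀ x, F.complex.d (n + 1) n (s x) = e x := by
  have := F.free n
  -- `F_n` is free over `ℤ` because `ℤH` is; the lift is not required to be equivariant.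
  have : Module.Free ℤ (F.complex.X n) := Module.Free.trans (S := MonoidAlgebra ℤ H)
  let b := Module.Free.chooseBasis ℤ (F.complex.X n)
  choose y hy using he
  let s : F.complex.X n →ₗ[ℤ] F.complex.X (n + 1) := b.constr ℤ fun j => y (b j)
  refine ⟨s.toAddMonoidHom, fun x => ?_⟩
  have h : (F.complex.d (n + 1) n).hom.toAddMonoidHom.toIntLinearMap ∘ₗ s = e.toIntLinearMap :=
    b.ext fun j => by
      change F.complex.d (n + 1) n (s (b j)) = e (b j)
      rw [b.constr_basis, hy]
  exact LinearMap.congr_fun h x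

/-- The image of the differential `F_{n + 1} ⟶ F_n` is a direct summand as an abelian group. -/
lemma exists_projection (n : ℕ) : ∃ e : F.complex.X n →+ F.complex.X n,
    (∀ x, ∃ y : F.complex.X (n + 1), F.complex.d (n + 1) n y = e x) ∧
      ∀ y : F.complex.X (n + 1), e (F.complex.d (n + 1) n y) = F.complex.d (n + 1) n y := by
  induction n with
  | zero =>
    obtain ⟨x₀, hx₀⟩ := F.aug_surjective 1
    -- As `ε(x₀) = 1`, this projects onto `Ker ε`, the image of `F_1`.
    refine ⟨AddMonoidHom.mk' (fun x => x - F.aug x • x₀) fun x y => ?_, fun x => ?_, fun y => ?_⟩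
    · rw [map_add, add_smul, add_sub_add_comm]
    · refine (F.aug_eq_zero_iff _).1 ?_
      change F.aug (x - F.aug x • x₀) = 0
      simp [hx₀]
    · change F.complex.d 1 0 y - F.aug (F.complex.d 1 0 y) • x₀ = F.complex.d 1 0 y
      rw [(F.aug_eq_zero_iff _).2 ⟨y, rfl⟩, zero_smul, sub_zero]
  | succ n hn =>
    obtain ⟨e, he, he'⟩ := hn
    obtain ⟨s, hs⟩ := F.exists_lift n e he
    -- `s` lifts the projection `e` onto the image of `d`, so `d s d = d` and `x - s(d x)` is a
    -- cycle, hence a boundary. Boundaries are left unchanged.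
    refine ⟨AddMonoidHom.mk' (fun x => x - s (F.complex.d (n + 1) n x)) fun x y => ?_,
      fun x => ?_, fun y => ?_⟩
    · rw [map_add, map_add, add_sub_add_comm]
    · refine F.exists_eq_of_d_eq_zero n _ ?_
      change F.complex.d (n + 1) n (x - s (F.complex.d (n + 1) n x)) = 0
      rw [map_sub, hs, he', sub_self]
    · change F.complex.d (n + 2) (n + 1) y -
        s (F.complex.d (n + 1) n (F.complex.d (n + 2) (n + 1) y)) = F.complex.d (n + 2) (n + 1) y
      rw [F.d_d, map_zero, sub_zero]

/-- A homomorphism which vanishes on the image of `F_{n + 2}` factors through the differential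
`F_{n + 1} ⟶ F_n`. -/
lemma exists_factorization (n : ℕ) {G : Type*} [AddCommGroup G] (g : F.complex.X (n + 1) →+ G)
    (hg : ∀ y : F.complex.X (n + 2), g (F.complex.d (n + 2) (n + 1) y) = 0) :
    ∃ g' : F.complex.X n →+ G, ∀ x, g' (F.complex.d (n + 1) n x) = g x := by
  obtain ⟨e, he, he'⟩ := F.exists_projection n
  obtain ⟨s, hs⟩ := F.exists_lift n e he
  -- `s(d x) - x` is a cycle, hence a boundary, and `g` kills it.
  refine ⟨g.comp s, fun x => ?_⟩
  obtain ⟨y, hy⟩ := F.exists_eq_of_d_eq_zero n (s (F.complex.d (n + 1) n x) - x) (by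
    rw [map_sub, hs, he', sub_self])
  rw [← sub_eq_zero]
  change g (s (F.complex.d (n + 1) n x)) - g x = 0
  rw [← map_sub, ← hy, hg]

/-- A homomorphism which vanishes on the image of `F_1` factors through the augmentation. -/
lemma exists_factorization_aug {G : Type*} [AddCommGroup G] (g : F.complex.X 0 →+ G)
    (hg : ∀ y : F.complex.X 1, g (F.complex.d 1 0 y) = 0) :
    ∃ c : G, ∀ x, F.aug x • c = g x := by
  obtain ⟨x₀, hx₀⟩ := F.aug_surjective 1
  refine ⟨g x₀, fun x => ?_⟩
  obtain ⟨y, hy⟩ := (F.aug_eq_zero_iff (x - F.aug x • x₀)).1 (by simp [hx₀])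
  rw [← map_zsmul, eq_comm, ← sub_eq_zero, ← map_sub, ← hy, hg]

end FreeResolution

variable {P : Type u} [Category.{v} P] [Abelian P] [HasProducts.{v} P] {H : Type v} [Group H]
  {M N : ModuleCat.{v} (MonoidAlgebra ℤ H)} {A : Action P H} {X : P}

/-- An invariant `α` satisfies `α(m)_h = h α(h⁻¹ m)_1`, so it is determined by the additive map `m ↦
α(m)_1`. Together with `exists_homFixedEval_CH`, which allows any additive map, this identifies
`Hom(M, C_H(A))^H` with `Hom(M, A)`. -/
lemma homFixedEval_CH_π (m : M) (h : H) :
    (homFixedEval m : homFixed M ((CH P H).obj A) ⟶ _) ≫ CHπ A h =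
      homFixedEval (smulHom M h⁻¹ m) ≫ CHπ A 1 ≫ act A h := by
  rw [homFixedEval_smul, Category.assoc, ← Category.assoc (act _ _), CH_act_π, inv_inv, mul_one,
    Category.assoc, ← act_mul, mul_inv_cancel, act_one, Category.comp_id]

lemma homFixed_CH_ext {f g : X ⟶ homFixed M ((CH P H).obj A)}
    (w : ∀ m : M, f ≫ homFixedEval m ≫ CHπ A 1 = g ≫ homFixedEval m ≫ CHπ A 1) : f = g := by
  refine homFixed_ext fun m => CH_hom_ext fun h => ?_
  have w' := congrArg (· ≫ act A h) (w (smulHom M h⁻¹ m))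
  simp only [Category.assoc] at w' ⊢
  rw [homFixedEval_CH_π, w']

/-- The homomorphisms from `M` to `Hom(X, A)` give morphisms `X ⟶ Hom(M, C_H(A))^H`. -/
lemma exists_homFixedEval_CH (f : M →+ (X ⟶ A.V)) :
    ∃ g : X ⟶ homFixed M ((CH P H).obj A), ∀ m, g ≫ homFixedEval m ≫ CHπ A 1 = f m := by
  let f' : M →+ (X ⟶ ((CH P H).obj A).V) :=
    AddMonoidHom.mk' (fun m => CHlift fun h => f (smulHom M h⁻¹ m) ≫ act A h) fun m n =>
      CH_hom_ext fun h => by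
        rw [Preadditive.add_comp, CHlift_π, CHlift_π, CHlift_π, map_add, map_add,
          Preadditive.add_comp]
  have hf' (m : M) (h : H) : f' m ≫ CHπ A h = f (smulHom M h⁻¹ m) ≫ act A h := CHlift_π _ _
  refine ⟨homFixedLift f' fun γ m => CH_hom_ext fun h => ?_, fun m => ?_⟩
  · rw [hf', Category.assoc, CH_act_π, ← Category.assoc, hf', Category.assoc, ← act_mul,
      mul_inv_cancel_left, ← smulHom_mul, mul_inv_rev, inv_inv]
  · rw [← Category.assoc, homFixedLift_eval, hf', inv_one, smulHom_one, act_one, Category.comp_id]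

variable (F : FreeResolution H)

/-- The differentials of `Hom(F_*, A)^H`. -/
def homFixedD (A : Action P H) (n : ℕ) :
    homFixed (F.complex.X n) A ⟶ homFixed (F.complex.X (n + 1)) A :=
  ((fixedPointsComplex (homComplex P F.complex)).obj A).d n (n + 1)

lemma homFixedD_eval (A : Action P H) (n : ℕ) (m : F.complex.X (n + 1)) :
    homFixedD F A n ≫ homFixedEval m = homFixedEval (F.complex.d (n + 1) n m) :=
  (homFixedMap_eval (F.complex.d (n + 1) n) (𝟙 A) m).trans (Category.comp_id _)

lemma homFixedHom_d_of_comp_eq_zero {n : ℕ} (x : X ⟶ homFixed (F.complex.X n) A)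
    (hx : x ≫ homFixedD F A n = 0) (m : F.complex.X (n + 1)) :
    homFixedHom x (F.complex.d (n + 1) n m) = 0 := by
  change x ≫ homFixedEval _ = 0
  rw [← homFixedD_eval, ← Category.assoc, hx, zero_comp]

/-- The coaugmentation `A^H ⟶ Hom(F_0, A)^H`. -/
def homFixedCoaugmentation (A : Action P H) :
    (fixedPoints P H).obj A ⟶ homFixed (F.complex.X 0) A :=
  (fixedPointsCoaugmentation (homCoaugmentation P F)).app A

lemma homFixedCoaugmentation_eval (A : Action P H) (m : F.complex.X 0) :
    homFixedCoaugmentation F A ≫ homFixedEval m = F.aug m • fixedPointsι A := by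
  have h : homFixedCoaugmentation F A ≫ homFixedι (F.complex.X 0) A =
      fixedPointsι A ≫ homLift (augHom F A.V) :=
    fixedPoints_map_ι ((homCoaugmentation P F).app A)
  rw [homFixedEval, ← Category.assoc, h, Category.assoc, homLift_eval]
  simp [augHom]

/-- The objects `C_H(A)` are acyclic for `Hom(F_*, ·)^H`. -/
lemma isAcyclicFor_fixedPoints_homComplex_CH (A : Action P H) :
    IsAcyclicFor (fixedPointsCoaugmentation (homCoaugmentation P F)) ((CH P H).obj A) where
  mono := by
    -- Evaluation at an element of augmentation `1` recovers the inclusion of the fixed points.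
    obtain ⟨x₀, hx₀⟩ := F.aug_surjective 1
    have h : homFixedCoaugmentation F ((CH P H).obj A) ≫ homFixedEval x₀ =
        fixedPointsι ((CH P H).obj A) := by
      rw [homFixedCoaugmentation_eval, hx₀, one_smul]
    exact mono_of_mono_fac h
  exact_zero {B} (x : B ⟶ homFixed (F.complex.X 0) ((CH P H).obj A)) hx := by
    -- Taking components at `1` turns a cocycle into an additive map from `F_0` to the group of
    -- morphisms `B ⟶ A` that vanishes on boundaries. It factors through `ε`, and `C_H(A)^H ≅ A`
    -- converts the factor into fixed points; no refinement of `B` is needed.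
    obtain ⟨c, hc⟩ := F.exists_factorization_aug
      ((Preadditive.rightComp B (CHπ A 1)).comp (homFixedHom x)) fun y =>
        (congrArg (· ≫ CHπ A 1) (homFixedHom_d_of_comp_eq_zero F x hx y)).trans zero_comp
    have hc' (m : F.complex.X 0) : F.aug m • c = (x ≫ homFixedEval m) ≫ CHπ A 1 := hc m
    refine ⟨B, 𝟙 B, inferInstance, c ≫ (fixedPointsCHObjIso A).inv, ?_⟩
    have h1 : (fixedPointsCHObjIso A).inv ≫ fixedPointsι ((CH P H).obj A) ≫ CHπ A 1 = 𝟙 A.V :=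
      (fixedPointsCHObjIso A).inv_hom_id
    refine (Category.id_comp x).trans ?_
    change x = (c ≫ (fixedPointsCHObjIso A).inv) ≫ homFixedCoaugmentation F _
    refine homFixed_CH_ext fun m => ?_
    rw [← Category.assoc, ← hc', Category.assoc, ← Category.assoc (homFixedCoaugmentation F _),
      homFixedCoaugmentation_eval, Preadditive.zsmul_comp, Preadditive.comp_zsmul,
      Category.assoc, h1, Category.comp_id]
  exact_succ q {B} (x : B ⟶ homFixed (F.complex.X (q + 1)) ((CH P H).obj A)) hx := by
    obtain ⟨c, hc⟩ := F.exists_factorization q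
      ((Preadditive.rightComp B (CHπ A 1)).comp (homFixedHom x)) fun y =>
        (congrArg (· ≫ CHπ A 1) (homFixedHom_d_of_comp_eq_zero F x hx y)).trans zero_comp
    have hc' (m : F.complex.X (q + 1)) :
      c (F.complex.d (q + 1) q m) = (x ≫ homFixedEval m) ≫ CHπ A 1 := hc m
    obtain ⟨y, hy⟩ := exists_homFixedEval_CH c
    refine ⟨B, 𝟙 B, inferInstance, y, (Category.id_comp x).trans ?_⟩
    change x = y ≫ homFixedD F _ q
    refine homFixed_CH_ext fun m => ?_
    rw [Category.assoc, ← Category.assoc (homFixedD F _ q), homFixedD_eval, hy, hc',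
      Category.assoc]

/-- Such an `A` is an equivariant retract of `C_H(A)`. -/
lemma isAcyclicFor_fixedPoints_homComplex (hA : IsSplit (CH P H) (CHι P H) A) :
    IsAcyclicFor (fixedPointsCoaugmentation (homCoaugmentation P F)) A := by
  obtain ⟨r, hr⟩ := hA
  exact .of_retract ((CHι P H).app A) r hr (isAcyclicFor_fixedPoints_homComplex_CH F A)

end FreeResolutions

end ProGroupCohomology

end

theorem mainTheorem6 {A : Type u} [Category.{v} A] [Abelian A] (H : Type v) [Group H]
    [HasDerivedCategory.{w₁} (Action (Pro A) H)] [HasDerivedCategory.{w₂} (Pro A)] :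
    -- `C_H`, with `ι : Id ⟶ C_H`, is a resolution functor
    IsResolutionFunctor (CH (Pro A) H) (CHι (Pro A) H) ∧
    -- the functor `A ↦ C_H^*(A)^H` with values in complexes is exact
    PreservesFiniteLimits (fixedPointsComplex (resolution (CH (Pro A) H) (CHι (Pro A) H))) ∧
    PreservesFiniteColimits (fixedPointsComplex (resolution (CH (Pro A) H) (CHι (Pro A) H))) ∧
    -- the fixed point functor is right derivable, and it has a total right derived functor
    IsRightDerivablePlus (fixedPoints (Pro A) H) ∧
    (∃ (RΓ : DerivedCategory.Plus (Action (Pro A) H) ⥤ DerivedCategory.Plus (Pro A))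
      (α : toDerivedPlus (fixedPoints (Pro A) H) ⟶ DerivedCategory.Plus.Qh ⋙ RΓ),
      IsTotalRightDerivedPlus (fixedPoints (Pro A) H) RΓ α) ∧
    -- the total right derived functor is induced by `C_H^*(·)^H`, and by `Hom(F_*, ·)^H` for every
    -- free resolution `F_*` of the trivial `ℤH`-module `ℤ`
    (∀ (RΓ : DerivedCategory.Plus (Action (Pro A) H) ⥤ DerivedCategory.Plus (Pro A))
      (α : toDerivedPlus (fixedPoints (Pro A) H) ⟶ DerivedCategory.Plus.Qh ⋙ RΓ),
      IsTotalRightDerivedPlus (fixedPoints (Pro A) H) RΓ α →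
        IsInducedBy RΓ α
          (fixedPointsComplex (resolution (CH (Pro A) H) (CHι (Pro A) H)))
          (fixedPointsCoaugmentation (resolutionCoaugmentation (CH (Pro A) H) (CHι (Pro A) H)))
          (fixedPointsCoaugmentation_d _
            (resolutionCoaugmentation_d (CH (Pro A) H) (CHι (Pro A) H))) ∧
        ∀ F : FreeResolution H,
          IsInducedBy RΓ α
            (fixedPointsComplex (homComplex (Pro A) F.complex))
            (fixedPointsCoaugmentation (homCoaugmentation (Pro A) F))
            (fixedPointsCoaugmentation_d _ (homCoaugmentation_d F))) := by
  -- The same resolution `K ⟶ C_H^*(K)` serves both complex valued functors, because its terms are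
  -- split and split objects are acyclic for both.
  have hj := quasiIso_toTotPlusResolution (R := CH (Pro A) H) (ι := CHι (Pro A) H)
  have hI := isSplit_totPlus (isSplit_CH_obj (P := Pro A) (H := H))
  have hRΓ := exists_isTotalRightDerivedPlus
    (fixedPointsCoaugmentation (resolutionCoaugmentation (CH (Pro A) H) (CHι (Pro A) H)))
    (fixedPointsCoaugmentation_d _ (resolutionCoaugmentation_d (CH (Pro A) H) (CHι (Pro A) H)))
    _ (toTotPlusResolution (CH (Pro A) H) (CHι (Pro A) H)) hj
    fun K n => isAcyclicFor_fixedPoints_resolution (hI K n)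
  refine ⟨isResolutionFunctor_CH, inferInstance, inferInstance, ?_, hRΓ, fun RΓ α h =>
    ⟨isInducedBy_of_isAcyclicFor _ _ _ (toTotPlusResolution (CH (Pro A) H) (CHι (Pro A) H)) hj
      (fun K n => isAcyclicFor_fixedPoints_resolution (hI K n)) RΓ α h, fun F =>
      isInducedBy_of_isAcyclicFor _ _ _ (toTotPlusResolution (CH (Pro A) H) (CHι (Pro A) H)) hj
        (fun K n => isAcyclicFor_fixedPoints_homComplex F (hI K n)) RΓ α h⟩⟩
  obtain ⟨RΓ, α, h⟩ := hRΓ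
  exact IsTotalRightDerived.isRightDerivable h
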